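/- Let $K$ be a number field and let $E \subset \mathbb{P}_2$ be the elliptic curve over $K$ with projective equation $Y^2 Z = 4X^3 - g_2 X Z^2 - g_3 Z^3$ ($g_2, g_3 \in K$, $g_2^3 - 27 g_3^2 \neq 0$), with neutral element $\mathbf{0} = (0:1:0)$. For a place $v$ of $K$ let $|\cdot|_v$ be the absolute value in $v$ that extends the usual (real or $p$-adic) absolute value of $\mathbb{Q}$. Put $m_v = \log\max\{1, |g_2|_v, |g_3|_v\}$, and $c_v = 0$ if $v$ is finite, $c_v = 16$ if $v$ is infinite. Let $h$ be the absolute logarithmic Weil height on $\mathbb{P}_2(K)$, $$h(p_0:p_1:p_2) = \sum_{v} \frac{[K_v:\mathbb{Q}_v]}{[K:\mathbb{Q}]} \log \max_i |p_i|_v ,$$ put $\eta = h(1:g_2:g_3)$, and let $$\mathrm{dist}_v(\mathbf p,\mathbf q) = \frac{\max_{0 \le i<j \le 2} |p_i q_j - q_i p_j|_v}{\max_i |p_i|_v \cdot \max_i |q_i|_v}$$ be the $v$-adic projective distance on $\mathbb{P}_2(K)$. For $\mathbf x, \mathbf y \in E(K)$ let $\widehat h(\mathbf x) = \lim_{n\to\infty}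 h(n\mathbf x)/n^2$ be the Néron–Tate height, $\langle \mathbf x, \mathbf y\rangle = \frac12\left(\widehat h(\mathbf x+\mathbf y) - \widehat h(\mathbf x) - \widehat h(\mathbf y)\right)$ the associated scalar product, and $\cos(\mathbf x,\mathbf y) = \langle \mathbf x, \mathbf y\rangle / \left(\widehat h(\mathbf x)^{1/2}\, \widehat h(\mathbf y)^{1/2}\right)$ when $\widehat h(\mathbf x), \widehat h(\mathbf y) > 0$. Let $S$ be a finite set of places of $K$ and $(\lambda_v)_{v\in S}$ a family of real numbers $\lambda_v \ge 0$ with $$\sum_{v\in S} \frac{[K_v:\mathbb{Q}_v]}{[K:\mathbb{Q}]} \lambda_v = 1 ,$$ and let $\varepsilon > 0$ be real. Let $\mathbf x_1 \neq \mathbf x_2$ be points of $E(K)$ such that 1. $\cos(\mathbf x_1, \mathbf x_2) \ge 1 - \varepsilon/8$; 2. $\widehat h(\mathbf x_2) \ge \widehat h(\mathbf x_1) \ge \frac{1}{\varepsilon}(54\eta + 204)$; 3. $\mathrm{dist}_v(\mathbf x_j, \mathbf 0) < e^{-\lambda_v \varepsilon h(\mathbf x_j) - 2 m_v - c_v}$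 for $j = 1, 2$ and all $v \in S$. Then $$\widehat h(\mathbf x_2) \ge \left(1 + \tfrac13\sqrt{\varepsilon}\right) \widehat h(\mathbf x_1) .$$ -/

import Mathlib

noncomputable section

namespace EllipticApprox

open NumberField IsDedekindDomain Filter Topology

/-! ### Places of a number field -/

/-- The set `M_K` of all places of a number field: the infinite and the finite ones. -/
abbrev Place (K : Type*) [Field K] [NumberField K] := InfinitePlace K ⊕ FinitePlace K

section Places

variable {K : Type*} [Field K] [NumberField K]

/-- The completion `ℚ_v` of `ℚ` at the place below the maximal ideal `v`, realised as the
topological closure of the prime field in the completion `K_v`. -/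
def rationalClosure (v : HeightOneSpectrum (𝓞 K)) : Subfield (v.adicCompletion K) :=
  (⊥ : Subfield (v.adicCompletion K)).topologicalClosure

/-- The local degree `[K_v : ℚ_v]`. For an infinite place it is `1` if the place is real and `2`
if it is complex. -/
def localDegree : Place K → ℕ
  | .inl v => v.mult
  | .inr v => Module.finrank (rationalClosure v.maximalIdeal) (v.maximalIdeal.adicCompletion K)

/-- The absolute value `|x|_v` on `K` which extends the usual absolute value of `ℚ` (the real one,
or the `p`-adic one with `|p|_p = 1/p`). Mathlib's absolute value of a finite place has
`‖x‖_v = N(v)^(-ord_v x)`, which is `|x|_v ^ [K_v : ℚ_v]`. -/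
def absV : Place K → K → ℝ
  | .inl v, x => v x
  | .inr v, x => (v x) ^ (1 / (localDegree (.inr v : Place K) : ℝ))

/-- The constant `c_v`: `0` for finite `v` and `16` for infinite `v`. -/
def cConst : Place K → ℝ
  | .inl _ => 16
  | .inr _ => 0

/-- `m_v = log max(1, |g₂|_v, |g₃|_v)`. -/
def mConst (g₂ g₃ : K) (v : Place K) : ℝ :=
  Real.log (max 1 (max (absV v g₂) (absV v g₃)))

end Places

/-! ### Projective plane: height and `v`-adic distance -/

section Projective

variable {K : Type*} [Field K] [NumberField K]

/-- The absolute logarithmic (Weil) height of a point of `ℙ₂(K)`. Mathlib's height is relative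
to `K`, that is, not divided by `[K : ℚ]`. -/
def height (P : Projectivization K (Fin 3 → K)) : ℝ :=
  P.logHeight / (Module.finrank ℚ K : ℝ)

/-- The maximum of the `v`-adic absolute values of three elements. -/
def max3 (v : Place K) (a b c : K) : ℝ := max (absV v a) (max (absV v b) (absV v c))

/-- The `v`-adic projective distance in terms of systems of projective coordinates. -/
def distCoord (v : Place K) (p q : Fin 3 → K) : ℝ :=
  max3 v (p 0 * q 1 - q 0 * p 1) (p 0 * q 2 - q 0 * p 2) (p 1 * q 2 - q 1 * p 2) /
    (max3 v (p 0) (p 1) (p 2) * max3 v (q 0) (q 1) (q 2))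

/-- The `v`-adic projective distance on `ℙ₂(K)`. -/
def dist (v : Place K) (P Q : Projectivization K (Fin 3 → K)) : ℝ :=
  distCoord v P.rep Q.rep

theorem absV_mul (v : Place K) (x y : K) : absV v (x * y) = absV v x * absV v y := by
  cases v with
  | inl v => simp [absV]
  | inr v => simp only [absV, map_mul]; exact Real.mul_rpow (apply_nonneg v x) (apply_nonneg v y)

theorem absV_nonneg (v : Place K) (x : K) : 0 ≤ absV v x := by
  cases v with
  | inl v => exact apply_nonneg v x
  | inr v => exact Real.rpow_nonneg (apply_nonneg v x) _

theorem absV_pos (v : Place K) {x : K} (hx : x ≠ 0) : 0 < absV v x := by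
  cases v with
  | inl v => exact InfinitePlace.pos_iff.2 hx
  | inr v => exact Real.rpow_pos_of_pos (FinitePlace.pos_iff.2 hx) _

theorem max3_mul (v : Place K) (t a b c : K) :
    max3 v (t * a) (t * b) (t * c) = absV v t * max3 v a b c := by
  simp only [max3, absV_mul, mul_max_of_nonneg _ _ (absV_nonneg v t)]

theorem distCoord_smul (v : Place K) {s t : K} (hs : s ≠ 0) (ht : t ≠ 0) (p q : Fin 3 → K) :
    distCoord v (s • p) (t • q) = distCoord v p q := by
  have h1 := (absV_pos v hs).ne'
  have h2 := (absV_pos v ht).ne'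
  have e : ∀ i j : Fin 3, (s • p) i * (t • q) j - (t • q) i * (s • p) j
      = (s * t) * (p i * q j - q i * p j) := by
    intro i j; simp only [Pi.smul_apply, smul_eq_mul]; ring
  unfold distCoord
  rw [e, e, e, max3_mul]
  simp only [Pi.smul_apply, smul_eq_mul, max3_mul, absV_mul]
  rw [show absV v s * max3 v (p 0) (p 1) (p 2) * (absV v t * max3 v (q 0) (q 1) (q 2))
    = (absV v s * absV v t) * (max3 v (p 0) (p 1) (p 2) * max3 v (q 0) (q 1) (q 2)) by ring]
  exact mul_div_mul_left _ _ (mul_ne_zero h1 h2)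

/-- The distance does not depend on the systems of projective coordinates. -/
theorem dist_mk (v : Place K) {p q : Fin 3 → K} (hp : p ≠ 0) (hq : q ≠ 0) :
    dist v (Projectivization.mk K p hp) (Projectivization.mk K q hq) = distCoord v p q := by
  obtain ⟨a, ha⟩ := Projectivization.exists_smul_eq_mk_rep K p hp
  obtain ⟨b, hb⟩ := Projectivization.exists_smul_eq_mk_rep K q hq
  rw [dist, ← ha, ← hb]
  exact distCoord_smul v a.ne_zero b.ne_zero p q

/-- `η = h(1 : g₂ : g₃)`. -/
def eta (g₂ g₃ : K) : ℝ :=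
  height (Projectivization.mk K ![1, g₂, g₃] fun h => one_ne_zero (congrFun h 0))

end Projective

/-! ### The elliptic curve `Y² Z = 4 X³ - g₂ X Z² - g₃ Z³` -/

section Curve

variable {K : Type*} [Field K] [NumberField K]

/-- The Weierstrass curve `y'² = x³ - (g₂/4) x - g₃/4`. By `y = 2 y'` it is the affine curve
`y² = 4 x³ - g₂ x - g₃`; this linear change of variables respects the group laws. -/
def curve (g₂ g₃ : K) : WeierstrassCurve.Affine K := ⟨0, 0, 0, -g₂ / 4, -g₃ / 4⟩

theorem curve_Δ (g₂ g₃ : K) : (curve g₂ g₃).Δ = g₂ ^ 3 - 27 * g₃ ^ 2 := by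
  simp only [curve, WeierstrassCurve.Δ, WeierstrassCurve.b₂, WeierstrassCurve.b₄,
    WeierstrassCurve.b₆, WeierstrassCurve.b₈]
  field_simp
  ring

/-- Projective coordinates `(X, Y, Z)` on `Y² Z = 4 X³ - g₂ X Z² - g₃ Z³` of a rational point:
`(0, 1, 0)` for the neutral element, `(x, 2y', 1)` for an affine point. -/
def coords (g₂ g₃ : K) : (curve g₂ g₃).Point → Fin 3 → K
  | .zero => ![0, 1, 0]
  | .some x y _ => ![x, 2 * y, 1]

theorem coords_ne_zero (g₂ g₃ : K) (P : (curve g₂ g₃).Point) : coords g₂ g₃ P ≠ 0 := by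
  cases P with
  | zero => exact fun h => one_ne_zero (congrFun h 1)
  | some x y h => exact fun h => one_ne_zero (congrFun h 2)

/-- The Weierstrass embedding `E(K) → ℙ₂(K)`. -/
def embed (g₂ g₃ : K) (P : (curve g₂ g₃).Point) : Projectivization K (Fin 3 → K) :=
  Projectivization.mk K (coords g₂ g₃ P) (coords_ne_zero g₂ g₃ P)

theorem embed_injective (g₂ g₃ : K) : Function.Injective (embed g₂ g₃) := by
  intro P Q h
  obtain ⟨a, ha⟩ := (Projectivization.mk_eq_mk_iff' K _ _ _ _).1 h
  have h0 := congrFun ha 0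
  have h1 := congrFun ha 1
  have h2 := congrFun ha 2
  cases P with
  | zero =>
    cases Q with
    | zero => rfl
    | some x y h =>
      simp [coords] at h0 h1 h2
      simp [h2] at h1
  | some x y h =>
    cases Q with
    | zero => simp [coords] at h2
    | some x' y' h' =>
      simp [coords] at h0 h1 h2
      subst h2
      simp at h0 h1
      subst h0 h1
      rfl

/-- The image of the embedding is the set of all `K`-rational points of the projective curve
`Y² Z = 4 X³ - g₂ X Z² - g₃ Z³`, if this curve is smooth. -/
theorem mk_mem_range_embed {g₂ g₃ : K} (hΔ : g₂ ^ 3 - 27 * g₃ ^ 2 ≠ 0) (X Y Z : K)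
    (h : ![X, Y, Z] ≠ 0) :
    Projectivization.mk K ![X, Y, Z] h ∈ Set.range (embed g₂ g₃) ↔
      Y ^ 2 * Z = 4 * X ^ 3 - g₂ * X * Z ^ 2 - g₃ * Z ^ 3 := by
  constructor
  · rintro ⟨P, hP⟩
    obtain ⟨a, ha⟩ := (Projectivization.mk_eq_mk_iff' K _ _ _ _).1 hP.symm
    have h0 := congrFun ha 0
    have h1 := congrFun ha 1
    have h2 := congrFun ha 2
    cases P with
    | zero =>
      simp [coords] at h0 h1 h2
      simp [← h0, ← h2]
    | some x y hns =>
      simp [coords] at h0 h1 h2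
      have he := (WeierstrassCurve.Affine.equation_iff _ _).1 hns.1
      simp [curve] at he
      rw [← h0, ← h1, ← h2]
      field_simp at he
      linear_combination a ^ 3 * he
  · intro hE
    by_cases hZ : Z = 0
    · subst hZ
      have hX : X = 0 := by simpa using hE
      subst hX
      have hY : Y ≠ 0 := by
        rintro rfl
        apply h
        ext i
        fin_cases i <;> rfl
      refine ⟨.zero, (Projectivization.mk_eq_mk_iff' K _ _ _ _).2 ⟨Y⁻¹, ?_⟩⟩
      ext i
      fin_cases i <;> simp [coords, hY]
    · have hEq : (curve g₂ g₃).Equation (X / Z) (Y / (2 * Z)) := by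
        rw [WeierstrassCurve.Affine.equation_iff]
        simp only [curve]
        field_simp
        linear_combination 4 * hE
      have hns : (curve g₂ g₃).Nonsingular (X / Z) (Y / (2 * Z)) :=
        (WeierstrassCurve.Affine.equation_iff_nonsingular_of_Δ_ne_zero
          (by rw [curve_Δ]; exact hΔ)).1 hEq
      refine ⟨.some _ _ hns, (Projectivization.mk_eq_mk_iff' K _ _ _ _).2 ⟨Z⁻¹, ?_⟩⟩
      ext i
      fin_cases i <;> simp [coords] <;> field_simp

/-- The height `h(x)` of a rational point of `E`. -/
def pointHeight (g₂ g₃ : K) (P : (curve g₂ g₃).Point) : ℝ := height (embed g₂ g₃ P)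

/-- The distance `dist_v(x, 0)` of a rational point of `E` to the neutral element. -/
def distZero (g₂ g₃ : K) (v : Place K) (P : (curve g₂ g₃).Point) : ℝ :=
  dist v (embed g₂ g₃ P) (embed g₂ g₃ 0)

variable [DecidableEq K]

/-- The Néron–Tate height `ĥ(x) = lim h(n x) / n²`. -/
def neronTate (g₂ g₃ : K) (P : (curve g₂ g₃).Point) : ℝ :=
  limUnder atTop fun n : ℕ => pointHeight g₂ g₃ (n • P) / (n : ℝ) ^ 2

/-- The scalar product of the Euclidean space `E(K) ⊗ ℝ` with `|x|² = ĥ(x)`, on the images of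
rational points. -/
def neronTateInner (g₂ g₃ : K) (P Q : (curve g₂ g₃).Point) : ℝ :=
  (neronTate g₂ g₃ (P + Q) - neronTate g₂ g₃ P - neronTate g₂ g₃ Q) / 2

/-- The cosine of the angle of two rational points in the Euclidean space `E(K) ⊗ ℝ`. -/
def cosAngle (g₂ g₃ : K) (P Q : (curve g₂ g₃).Point) : ℝ :=
  neronTateInner g₂ g₃ P Q / (√(neronTate g₂ g₃ P) * √(neronTate g₂ g₃ Q))

end Curve

end EllipticApprox

end

noncomputable section

namespace EllipticApprox

open NumberField IsDedekindDomain Filter Topology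

/-! The proof weighs the difference x = x₁ - x₂ in two ways. Both points are close to the origin at
the places of S, and the group law is nearly additive there, so x is close to the origin too:
dist_v(x, 0) < exp(-λ_v ε min h(x_j)) (`distZero_sub_lt`, resting on `chord_bound`). As x ≠ 0, the
Liouville inequality `lt_pointHeight` sums these local estimates, with total weight 1, to h(x) > ε
min h(x_j).

On the other hand, the parallelogram law expresses ĥ(x) through ĥ(x₁), ĥ(x₂) and the cosine. If
ĥ(x₂) < (1 + √ε/3) ĥ(x₁), the two vectors have nearly the same length and direction, and
`sq_length_sub_le` gives ĥ(x) ≤ (23/72) ε ĥ(x₁). Put κ = 18η + 68. Since |h - ĥ| ≤ κ and ε ĥ(x₁) ≥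
3κ, the two estimates contradict each other once ε < 1; and ε < 1 follows from the Liouville
inequality for x₁ alone.

The comparison of h and ĥ is made explicit. The map `addSub` takes the symmetric functions of x(P),
x(Q) to those of x(P + Q), x(P - Q). It consists of quadratic forms without common zero, so it
doubles heights up to a bounded error, with an explicit elimination identity for the lower bound.
This yields the parallelogram law for h up to a constant, and Tate's telescoping argument turns it
into an exact law for ĥ.

All estimates are polynomial. They are proved once for functions with f(a + b) ≤ c max(f a, f b),
where c = 2 or c = 1, by counting factors: `IsBounded` records the exponents of c, of the size of
the coefficients, and of the size of the variables. -/

/-! ### Quasi-ultrametric absolute values -/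

/-- A multiplicative function `f` with `f (a + b) ≤ c * max (f a) (f b)`. This treats
archimedean (`c = 2`) and nonarchimedean (`c = 1`) absolute values uniformly. -/
structure IsQuasiAbs {K : Type*} [Field K] (f : K → ℝ) (c : ℝ) : Prop where
  one_le : 1 ≤ c
  nonneg : ∀ a, 0 ≤ f a
  zero : f 0 = 0
  one : f 1 = 1
  neg : ∀ a, f (-a) = f a
  mul : ∀ a b, f (a * b) = f a * f b
  add : ∀ a b, f (a + b) ≤ c * max (f a) (f b)

namespace IsQuasiAbs

variable {K : Type*} [Field K] {f : K → ℝ} {c : ℝ}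

theorem of_absoluteValue (v : AbsoluteValue K ℝ) : IsQuasiAbs v 2 where
  one_le := one_le_two
  nonneg := v.nonneg
  zero := v.map_zero
  one := v.map_one
  neg := v.map_neg
  mul := v.map_mul
  add a b := by
    have := v.add_le a b
    linarith [le_max_left (v a) (v b), le_max_right (v a) (v b)]

theorem of_isNonarchimedean (v : AbsoluteValue K ℝ) (hv : IsNonarchimedean v) :
    IsQuasiAbs v 1 where
  one_le := le_rfl
  nonneg := v.nonneg
  zero := v.map_zero
  one := v.map_one
  neg := v.map_neg
  mul := v.map_mul
  add a b := by simpa using hv a b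

variable (h : IsQuasiAbs f c)

include h

theorem c_pos : 0 < c := zero_lt_one.trans_le h.one_le

theorem pos {a : K} (ha : a ≠ 0) : 0 < f a := by
  refine (h.nonneg a).lt_of_ne fun h0 => ?_
  have := h.mul a a⁻¹
  rw [mul_inv_cancel₀ ha, h.one, ← h0, zero_mul] at this
  exact one_ne_zero this

theorem div (a : K) {b : K} (hb : b ≠ 0) : f (a / b) = f a / f b := by
  rw [eq_div_iff (h.pos hb).ne', ← h.mul, div_mul_cancel₀ a hb]

theorem add_le_of_le {a b : K} {B : ℝ} (ha : f a ≤ B) (hb : f b ≤ B) : f (a + b) ≤ c * B :=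
  (h.add a b).trans (mul_le_mul_of_nonneg_left (max_le ha hb) h.c_pos.le)

/-- Halving: an integer up to 2 ^ (k + 1) is the sum of two integers up to 2 ^ k, and each addition
costs one factor c. -/
theorem natCast_le (k : ℕ) : ∀ n : ℕ, n ≤ 2 ^ k → f (n : K) ≤ c ^ k := by
  induction k with
  | zero =>
    intro n hn
    interval_cases n <;> simp [h.zero, h.one]
  | succ k ih =>
    intro n hn
    have e : n = n / 2 + (n - n / 2) := by omega
    rw [e, Nat.cast_add, pow_succ']
    exact h.add_le_of_le (ih _ (by rw [pow_succ] at hn; omega)) (ih _ (by rw [pow_succ] at hn; omega))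

/-- If `a` is small then `1 + a` is not. -/
theorem one_le_mul_one_add {a : K} (ha : c * f a < 1) : 1 ≤ c * f (1 + a) := by
  have := h.add (1 + a) (-a)
  rw [add_neg_cancel_right, h.one, h.neg] at this
  rcases max_choice (f (1 + a)) (f a) with e | e <;> rw [e] at this
  · exact this
  · linarith

end IsQuasiAbs

/-- `a` has size at most `c ^ k * M ^ m * N ^ n`. -/
def IsBounded {K : Type*} (f : K → ℝ) (c M N : ℝ) (k m n : ℕ) (a : K) : Prop :=
  f a ≤ c ^ k * M ^ m * N ^ n

namespace IsBounded

variable {K : Type*} [Field K] {f : K → ℝ} {c M N : ℝ} {k m n k' m' n' : ℕ} {a b : K}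

theorem mono (h : IsQuasiAbs f c) (hM : 1 ≤ M) (hN : 0 ≤ N) (ha : IsBounded f c M N k m n a)
    (hk : k ≤ k') (hm : m ≤ m') (hn : n = n') : IsBounded f c M N k' m' n' a := by
  subst hn
  have := h.one_le
  unfold IsBounded at *
  refine ha.trans ?_
  gcongr

theorem mul (h : IsQuasiAbs f c) (hM : 1 ≤ M) (hN : 0 ≤ N) (ha : IsBounded f c M N k m n a)
    (hb : IsBounded f c M N k' m' n' b) :
    IsBounded f c M N (k + k') (m + m') (n + n') (a * b) := by
  have h1 := h.c_pos
  unfold IsBounded at *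
  rw [h.mul]
  calc f a * f b ≤ (c ^ k * M ^ m * N ^ n) * (c ^ k' * M ^ m' * N ^ n') :=
        mul_le_mul ha hb (h.nonneg b) (by positivity)
    _ = _ := by ring

theorem pow (h : IsQuasiAbs f c) (hM : 1 ≤ M) (hN : 0 ≤ N) (ha : IsBounded f c M N k m n a)
    (l : ℕ) : IsBounded f c M N (k * l) (m * l) (n * l) (a ^ l) := by
  induction l with
  | zero => simp [IsBounded, h.one]
  | succ l ih => simpa only [pow_succ, mul_add, mul_one] using ih.mul h hM hN ha

theorem add (h : IsQuasiAbs f c) (hM : 1 ≤ M) (hN : 0 ≤ N) (ha : IsBounded f c M N k m n a)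
    (hb : IsBounded f c M N k' m' n' b) (hn : n' = n) :
    IsBounded f c M N (max k k' + 1) (max m m') n (a + b) := by
  subst hn
  have h1 := h.add_le_of_le (ha.mono h hM hN (le_max_left k k') (le_max_left m m') rfl)
    (hb.mono h hM hN (le_max_right k k') (le_max_right m m') rfl)
  unfold IsBounded
  rwa [pow_succ', mul_assoc, mul_assoc, ← mul_assoc (c ^ _)]

theorem neg (h : IsQuasiAbs f c) (ha : IsBounded f c M N k m n a) :
    IsBounded f c M N k m n (-a) := by
  unfold IsBounded
  rw [h.neg]
  exact ha

theorem sub (h : IsQuasiAbs f c) (hM : 1 ≤ M) (hN : 0 ≤ N) (ha : IsBounded f c M N k m n a)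
    (hb : IsBounded f c M N k' m' n' b) (hn : n' = n) :
    IsBounded f c M N (max k k' + 1) (max m m') n (a - b) := by
  rw [sub_eq_add_neg]
  exact ha.add h hM hN (hb.neg h) hn

theorem ofNat (h : IsQuasiAbs f c) (l : ℕ) [l.AtLeastTwo] :
    IsBounded f c M N (Nat.log2 l + 1) 0 0 (OfNat.ofNat l : K) := by
  have := h.natCast_le (Nat.log2 l + 1) l Nat.lt_log2_self.le
  have e : (l : K) = OfNat.ofNat l := Nat.cast_ofNat (R := K) (n := l)
  rw [e] at this
  simpa only [IsBounded, pow_zero, mul_one] using this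

end IsBounded

/-! ### Local bounds imply global bounds of heights -/

section Global

open Height Height.AdmissibleAbsValues Function

variable {K : Type*} [Field K] [AdmissibleAbsValues K]

/-- Zero coordinates do not change the supremum, and each nonzero coordinate has absolute value 1 at
almost all places. -/
theorem hasFiniteMulSupport_iSup {ι : Type*} [Finite ι] {x : ι → K} (hx : x ≠ 0) :
    (fun v : nonarchAbsVal (K := K) ↦ ⨆ i, v.val (x i)).HasFiniteMulSupport := by
  have : Nonempty {j // x j ≠ 0} := nonempty_subtype.mpr <| ne_iff.mp hx
  suffices (fun v : nonarchAbsVal (K := K) ↦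
      ⨆ i : {j // x j ≠ 0}, v.val (x i)).HasFiniteMulSupport by
    convert! this with v
    obtain ⟨i, hi⟩ : ∃ j, x j ≠ 0 := Function.ne_iff.mp hx
    have : Nonempty ι := .intro i
    refine le_antisymm (ciSup_le fun j ↦ ?_) (ciSup_le fun ⟨j, hj⟩ ↦ Finite.le_ciSup_of_le j le_rfl)
    rcases eq_or_ne (x j) 0 with h | h
    · rw [h, v.val.map_zero]
      exact Real.iSup_nonneg' ⟨⟨i, hi⟩, v.val.nonneg ..⟩
    · exact Finite.le_ciSup_of_le ⟨j, h⟩ le_rfl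
  fun_prop (disch := grind)

theorem prod_archAbsVal_iSup_nonneg {ι : Type*} (x : ι → K) :
    0 ≤ (Multiset.map (fun v : AbsoluteValue K ℝ ↦ ⨆ i, v (x i)) archAbsVal).prod :=
  Multiset.prod_map_nonneg fun v _ ↦ Real.iSup_nonneg_of_nonnegHomClass v _

/-- A bound for the coordinates of `y` in terms of those of `g`, `x`, `z`, valid for all places,
yields a bound for the height of `y`. -/
theorem logHeight_le_of_local {κ ι₁ ι₂ ι₃ : Type*} [Finite κ] [Finite ι₁] [Finite ι₂] [Finite ι₃]
    {y : κ → K} {g : ι₁ → K} {x : ι₂ → K} {z : ι₃ → K}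
    (hy : y ≠ 0) (hg : g ≠ 0) (hx : x ≠ 0) (hz : z ≠ 0) (k m n l : ℕ)
    (H : ∀ (v : AbsoluteValue K ℝ) (c : ℝ), IsQuasiAbs v c → ∀ j,
      v (y j) ≤ c ^ k * (⨆ i, v (g i)) ^ m * (⨆ i, v (x i)) ^ n * (⨆ i, v (z i)) ^ l) :
    logHeight y ≤ totalWeight K * (k * Real.log 2) + m * logHeight g + n * logHeight x
      + l * logHeight z := by
  have : Nonempty κ := (ne_iff.mp hy).nonempty
  have fg := hasFiniteMulSupport_iSup hg
  have fx := hasFiniteMulSupport_iSup hx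
  have fz := hasFiniteMulSupport_iSup hz
  have fgm : (fun v : nonarchAbsVal (K := K) ↦ (⨆ i, v.val (g i)) ^ m).HasFiniteMulSupport :=
    fg.pow m
  have fxn : (fun v : nonarchAbsVal (K := K) ↦ (⨆ i, v.val (x i)) ^ n).HasFiniteMulSupport :=
    fx.pow n
  have fzl : (fun v : nonarchAbsVal (K := K) ↦ (⨆ i, v.val (z i)) ^ l).HasFiniteMulSupport :=
    fz.pow l
  have fgx : (fun v : nonarchAbsVal (K := K) ↦
      (⨆ i, v.val (g i)) ^ m * (⨆ i, v.val (x i)) ^ n).HasFiniteMulSupport := fgm.mul fxn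
  have key : mulHeight y ≤ ((2 : ℝ) ^ k) ^ totalWeight K * mulHeight g ^ m * mulHeight x ^ n
      * mulHeight z ^ l := by
    rw [mulHeight_eq hy, mulHeight_eq hg, mulHeight_eq hx, mulHeight_eq hz]
    simp only [mul_pow]
    rw [finprod_pow fg, finprod_pow fx, finprod_pow fz]
    have e : ∀ A a a' b b' d d' : ℝ, A * (a * a') * (b * b') * (d * d')
        = (A * a * b * d) * (a' * b' * d') := by intros; ring
    rw [e, ← finprod_mul_distrib fgm fxn, ← finprod_mul_distrib fgx fzl]
    refine mul_le_mul ?_ ?_ (finprod_nonneg fun v ↦ Real.iSup_nonneg_of_nonnegHomClass ..) ?_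
    -- `totalWeight K` counts the archimedean absolute values with multiplicity, so one factor 2 ^ k
    -- for each gives the whole constant. The nonarchimedean ones have c = 1 and contribute none.
    · rw [totalWeight, ← Multiset.prod_replicate, ← Multiset.map_const', ← Multiset.prod_map_pow,
        ← Multiset.prod_map_pow, ← Multiset.prod_map_pow, ← Multiset.prod_map_mul,
        ← Multiset.prod_map_mul, ← Multiset.prod_map_mul]
      refine Multiset.prod_map_le_prod_map₀ _ _
        (fun v _ ↦ Real.iSup_nonneg_of_nonnegHomClass v _) fun v _ ↦ ?_
      exact ciSup_le (H v 2 (.of_absoluteValue v))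
    · refine finprod_le_finprod (hasFiniteMulSupport_iSup hy)
        (fun v ↦ Real.iSup_nonneg_of_nonnegHomClass v.val _)
        (fgx.mul fzl) fun v ↦ ?_
      refine ciSup_le fun j ↦ ?_
      simpa using H v.val 1 (.of_isNonarchimedean v.val (isNonarchimedean _ v.prop)) j
    · have h1 := prod_archAbsVal_iSup_nonneg g
      have h2 := prod_archAbsVal_iSup_nonneg x
      have h3 := prod_archAbsVal_iSup_nonneg z
      positivity
  have := Real.log_le_log (mulHeight_pos y) key
  have pg := mulHeight_pos g
  have px := mulHeight_pos x
  have pz := mulHeight_pos z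
  rw [Real.log_mul (by positivity) (by positivity), Real.log_mul (by positivity) (by positivity),
    Real.log_mul (by positivity) (by positivity), Real.log_pow, Real.log_pow, Real.log_pow,
    Real.log_pow, Real.log_pow] at this
  exact this

end Global

/-! ### The addition-and-subtraction map in terms of `g₂`, `g₃` -/

section AddSub

open Height

variable {K : Type*} [Field K]

/-- Sixteen times the quadratic map that sends `(x(P) x(Q), x(P) + x(Q), 1)` to
`(x(P + Q) x(P - Q), x(P + Q) + x(P - Q), 1)`. -/
def addSub (g₂ g₃ s t u : K) : Fin 3 → K :=
  ![16 * s ^ 2 + 8 * g₂ * s * u + 16 * g₃ * t * u + g₂ ^ 2 * u ^ 2,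
    32 * t * s - 8 * g₂ * t * u - 16 * g₃ * u ^ 2,
    16 * t ^ 2 - 64 * s * u]

/-- Quadratic forms that express the fourth powers of the coordinates through `addSub`. -/
def addSubCoeff (g₂ g₃ s t u : K) : Fin 3 → Fin 3 → K :=
  ![![512 * (g₂ ^ 3 - 27 * g₃ ^ 2) * s ^ 2 - 64 * g₂ ^ 2 * g₃ * s * t - 256 * g₂ * g₃ ^ 2 * s * u
        + (768 * g₂ * g₃ ^ 2 - 24 * g₂ ^ 4) * t ^ 2 + (1536 * g₃ ^ 3 - 48 * g₂ ^ 3 * g₃) * t * u,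
      32 * g₂ ^ 2 * g₃ * s ^ 2 + (512 * g₂ * g₃ ^ 2 - 20 * g₂ ^ 4) * s * t
        - 16 * g₂ ^ 3 * g₃ * s * u + (1536 * g₃ ^ 3 - 48 * g₂ ^ 3 * g₃) * t ^ 2
        + (96 * g₂ ^ 2 * g₃ ^ 2 - 3 * g₂ ^ 5) * t * u,
      (64 * g₂ ^ 4 - 1792 * g₂ * g₃ ^ 2) * s ^ 2 + (96 * g₂ ^ 3 * g₃ - 3072 * g₃ ^ 3) * s * t
        + (8 * g₂ ^ 5 - 256 * g₂ ^ 2 * g₃ ^ 2) * s * u],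
    ![-(49152 * g₃ * s * t) + 2048 * g₂ ^ 2 * t ^ 2 + 4096 * g₂ * g₃ * t * u,
      24576 * g₃ * s ^ 2 - 1024 * g₂ ^ 2 * s * t + 4096 * g₂ * g₃ * t ^ 2
        + 256 * g₂ ^ 3 * t * u,
      -(8192 * g₂ * g₃ * s * t) - 6144 * g₃ ^ 2 * s * u
        + 512 * (g₂ ^ 3 - 27 * g₃ ^ 2) * t ^ 2],
    ![-(6144 * t ^ 2) + 8192 * g₂ * u ^ 2,
      3072 * s * t + 1280 * g₂ * t * u + 13824 * g₃ * u ^ 2,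
      2048 * g₂ * s * u + 6144 * g₃ * t * u + 1024 * g₂ ^ 2 * u ^ 2]]

/-- An explicit Nullstellensatz certificate: for nonzero discriminant the three forms of `addSub`
have no common zero, and their size bounds that of (s, t, u) from below. -/
theorem addSubCoeff_mul_addSub (g₂ g₃ s t u : K) (i : Fin 3) :
    8192 * (g₂ ^ 3 - 27 * g₃ ^ 2) * ![s, t, u] i ^ 4 =
      addSubCoeff g₂ g₃ s t u i 0 * addSub g₂ g₃ s t u 0
      + addSubCoeff g₂ g₃ s t u i 1 * addSub g₂ g₃ s t u 1
      + addSubCoeff g₂ g₃ s t u i 2 * addSub g₂ g₃ s t u 2 := by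
  fin_cases i <;> simp [addSubCoeff, addSub] <;> ring


theorem isBounded_addSub {f : K → ℝ} {c M N : ℝ} (h : IsQuasiAbs f c) (hM : 1 ≤ M) (hN : 0 ≤ N)
    {g₂ g₃ s t u : K} (h2 : IsBounded f c M N 0 1 0 g₂) (h3 : IsBounded f c M N 0 1 0 g₃)
    (hs : IsBounded f c M N 0 0 1 s) (ht : IsBounded f c M N 0 0 1 t)
    (hu : IsBounded f c M N 0 0 1 u) (i : Fin 3) :
    IsBounded f c M N 10 2 2 (addSub g₂ g₃ s t u i) := by
  fin_cases i <;> simp only [addSub, Fin.zero_eta, Fin.mk_one, Fin.reduceFinMk, Matrix.cons_val] <;>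
    apply IsBounded.mono h hM hN
  -- The exponents are metavariables that the rules fill in along the shape of the polynomial. What
  -- remains are comparisons of numerals with the claimed exponents.
  all_goals repeat' with_reducible first
    | exact h2 | exact h3 | exact hs | exact ht | exact hu | rfl
    | exact IsBounded.ofNat h _
    | apply IsBounded.neg h
    | apply IsBounded.pow h hM hN
    | apply IsBounded.mul h hM hN
    | apply IsBounded.add h hM hN
    | apply IsBounded.sub h hM hN
    | decide +kernel

theorem isBounded_addSubCoeff {f : K → ℝ} {c M N : ℝ} (h : IsQuasiAbs f c) (hM : 1 ≤ M)
    (hN : 0 ≤ N) {g₂ g₃ s t u : K} (h2 : IsBounded f c M N 0 1 0 g₂)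
    (h3 : IsBounded f c M N 0 1 0 g₃)
    (hs : IsBounded f c M N 0 0 1 s) (ht : IsBounded f c M N 0 0 1 t)
    (hu : IsBounded f c M N 0 0 1 u) (i j : Fin 3) :
    IsBounded f c M N 22 5 2 (addSubCoeff g₂ g₃ s t u i j) := by
  fin_cases i <;> fin_cases j <;>
    simp only [addSubCoeff, Fin.zero_eta, Fin.mk_one, Fin.reduceFinMk, Matrix.cons_val] <;>
    apply IsBounded.mono h hM hN
  all_goals repeat' with_reducible first
    | exact h2 | exact h3 | exact hs | exact ht | exact hu | rfl
    | exact IsBounded.ofNat h _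
    | apply IsBounded.neg h
    | apply IsBounded.pow h hM hN
    | apply IsBounded.mul h hM hN
    | apply IsBounded.add h hM hN
    | apply IsBounded.sub h hM hN
    | decide +kernel

end AddSub
/-! ### Explicit height bounds -/

section HeightBounds

open Height

variable {K : Type*} [Field K]

theorem apply_le_iSup {ι : Type*} [Finite ι] (v : AbsoluteValue K ℝ) (x : ι → K) (i : ι) :
    v (x i) ≤ ⨆ j, v (x j) :=
  Finite.le_ciSup_of_le i le_rfl

theorem one_le_iSup_of_eq_one {ι : Type*} [Finite ι] (v : AbsoluteValue K ℝ) {x : ι → K} {i : ι}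
    (hi : x i = 1) : 1 ≤ ⨆ j, v (x j) := by
  simpa [hi] using apply_le_iSup v x i

theorem cons_one_ne_zero {n : ℕ} (x : Fin n → K) : Matrix.vecCons 1 x ≠ 0 :=
  fun h => one_ne_zero (congrFun h 0)

theorem isBounded_coeff {v : AbsoluteValue K ℝ} {c N : ℝ} (g₂ g₃ : K) :
    IsBounded v c (⨆ i, v (![1, g₂, g₃] i)) N 0 1 0 g₂ ∧
      IsBounded v c (⨆ i, v (![1, g₂, g₃] i)) N 0 1 0 g₃ := by
  constructor <;> simp only [IsBounded, pow_zero, pow_one, one_mul, mul_one]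
  · exact apply_le_iSup v ![1, g₂, g₃] 1
  · exact apply_le_iSup v ![1, g₂, g₃] 2

theorem isBounded_coord {ι : Type*} [Finite ι] {v : AbsoluteValue K ℝ} {c M : ℝ} (x : ι → K)
    (i : ι) : IsBounded v c M (⨆ i, v (x i)) 0 0 1 (x i) := by
  simpa [IsBounded] using apply_le_iSup v x i

theorem iSup_nonneg_abv {ι : Type*} (v : AbsoluteValue K ℝ) (x : ι → K) : 0 ≤ ⨆ i, v (x i) :=
  Real.iSup_nonneg_of_nonnegHomClass v x

/-! ### Heights of unordered pairs of points of the projective line. -/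

section Sym2

variable [AdmissibleAbsValues K]

theorem logHeight_sym2_le_explicit {a b c d : K} (hab : ![a, b] ≠ 0) (hcd : ![c, d] ≠ 0)
    (hs : ![a * c, a * d + b * c, b * d] ≠ 0) :
    logHeight ![a * c, a * d + b * c, b * d] ≤
      totalWeight K * Real.log 2 + logHeight ![a, b] + logHeight ![c, d] := by
  have := logHeight_le_of_local hs (g := ![(1 : K)]) (cons_one_ne_zero _) hab hcd 1 0 1 1
    fun v κ h j => by
      have ha := apply_le_iSup v ![a, b]
      have hc := apply_le_iSup v ![c, d]
      have h1 := iSup_nonneg_abv v ![a, b]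
      have h2 := iSup_nonneg_abv v ![c, d]
      set A := ⨆ i, v (![a, b] i)
      set B := ⨆ i, v (![c, d] i)
      have hp : ∀ i j, v (![a, b] i * ![c, d] j) ≤ A * B := fun i j => by
        rw [v.map_mul]; exact mul_le_mul (ha i) (hc j) (v.nonneg _) h1
      have hle : A * B ≤ κ * (A * B) := le_mul_of_one_le_left (by positivity) h.one_le
      simp only [pow_one, pow_zero, mul_one, mul_assoc]
      fin_cases j
      · exact (hp 0 0).trans hle
      · exact h.add_le_of_le (hp 0 1) (hp 1 0)
      · exact (hp 1 1).trans hle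
  simpa using this

/-- The left side is the height of the tensor product (ac, ad, bc, bd), so only ad and bc have to be
recovered from their sum and product. -/
theorem le_logHeight_sym2 {a b c d : K} (hab : ![a, b] ≠ 0) (hcd : ![c, d] ≠ 0)
    (hs : ![a * c, a * d + b * c, b * d] ≠ 0) :
    logHeight ![a, b] + logHeight ![c, d] ≤
      totalWeight K * Real.log 2 + logHeight ![a * c, a * d + b * c, b * d] := by
  have hy : (fun p : Fin 2 × Fin 2 ↦ ![a, b] p.1 * ![c, d] p.2) ≠ 0 := by
    obtain ⟨i, hi⟩ := Function.ne_iff.mp hab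
    obtain ⟨j, hj⟩ := Function.ne_iff.mp hcd
    exact Function.ne_iff.mpr ⟨⟨i, j⟩, mul_ne_zero hi hj⟩
  have := logHeight_le_of_local hy (g := ![(1 : K)]) (cons_one_ne_zero _) hs
    (z := ![(1 : K)]) (cons_one_ne_zero _) 1 0 1 0
    fun v κ h j => by
      have hS := apply_le_iSup v ![a * c, a * d + b * c, b * d]
      have h1 := iSup_nonneg_abv v ![a * c, a * d + b * c, b * d]
      set S := ⨆ i, v (![a * c, a * d + b * c, b * d] i)
      have hac : v (a * c) ≤ S := hS 0
      have hm : v (a * d + b * c) ≤ S := hS 1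
      have hbd : v (b * d) ≤ S := hS 2
      have hle : S ≤ κ * S := le_mul_of_one_le_left h1 h.one_le
      -- A root of a monic quadratic is bounded by its coefficients: if |p| > κS, then p² = p(p + q)
      -- - pq would have size at most κ|p|S < |p|².
      have key : ∀ p q : K, v (p + q) ≤ S → v (p * q) ≤ S * S → v p ≤ κ * S := by
        intro p q hpq hpq'
        by_contra! hlt
        have hSp : S < v p := hle.trans_lt hlt
        have h2 : v (p * (p + q) + -(p * q)) ≤ κ * (v p * S) := by
          refine h.add_le_of_le ?_ ?_
          · rw [v.map_mul]; exact mul_le_mul_of_nonneg_left hpq (v.nonneg _)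
          · rw [v.map_neg]; exact hpq'.trans (mul_le_mul_of_nonneg_right hSp.le h1)
        rw [show p * (p + q) + -(p * q) = p * p by ring, v.map_mul] at h2
        nlinarith [h1.trans_lt hSp]
      have hprod : v (a * c * (b * d)) ≤ S * S := by
        rw [v.map_mul]; exact mul_le_mul hac hbd (v.nonneg _) h1
      simp only [pow_one, pow_zero, mul_one]
      obtain ⟨i, j⟩ := j
      fin_cases i <;> fin_cases j
      · exact hac.trans hle
      · exact key (a * d) (b * c) hm (by rwa [show a * d * (b * c) = a * c * (b * d) by ring])
      · exact key (b * c) (a * d) (by rwa [add_comm])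
          (by rwa [show b * c * (a * d) = a * c * (b * d) by ring])
      · exact hbd.trans hle
  rw [logHeight_fun_mul_eq hab hcd] at this
  simpa using this

end Sym2

/-! ### Heights under `addSub` and under the Weierstrass embedding. -/

variable [CharZero K] {g₂ g₃ : K}

theorem addSub_ne_zero (hΔ : g₂ ^ 3 - 27 * g₃ ^ 2 ≠ 0) {s t u : K} (hx : ![s, t, u] ≠ 0) :
    addSub g₂ g₃ s t u ≠ 0 := by
  contrapose! hx
  ext i
  have := addSubCoeff_mul_addSub g₂ g₃ s t u i
  simp only [hx, Pi.zero_apply, mul_zero, add_zero] at this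
  simpa [hΔ] using this

variable [AdmissibleAbsValues K]

theorem logHeight_addSub_le (hΔ : g₂ ^ 3 - 27 * g₃ ^ 2 ≠ 0) {s t u : K} (hx : ![s, t, u] ≠ 0) :
    logHeight (addSub g₂ g₃ s t u) ≤ totalWeight K * (10 * Real.log 2)
      + 2 * logHeight ![1, g₂, g₃] + 2 * logHeight ![s, t, u] := by
  have := logHeight_le_of_local (addSub_ne_zero hΔ hx) (cons_one_ne_zero ![g₂, g₃]) hx
    (z := ![(1 : K)]) (cons_one_ne_zero _) 10 2 2 0 fun v c h j => by
      have := isBounded_addSub h (one_le_iSup_of_eq_one v (i := 0) (x := ![1, g₂, g₃]) rfl)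
        (iSup_nonneg_abv v ![s, t, u]) (isBounded_coeff g₂ g₃).1 (isBounded_coeff g₂ g₃).2
        (isBounded_coord ![s, t, u] 0) (isBounded_coord ![s, t, u] 1)
        (isBounded_coord ![s, t, u] 2) j
      simpa [IsBounded] using this
  simpa using this

theorem logHeight_le_addSub (hΔ : g₂ ^ 3 - 27 * g₃ ^ 2 ≠ 0) {s t u : K} (hx : ![s, t, u] ≠ 0) :
    2 * logHeight ![s, t, u] ≤ totalWeight K * (24 * Real.log 2)
      + 5 * logHeight ![1, g₂, g₃] + logHeight (addSub g₂ g₃ s t u) := by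
  have hC : 8192 * (g₂ ^ 3 - 27 * g₃ ^ 2) ≠ 0 := mul_ne_zero (by norm_num) hΔ
  have hy : (8192 * (g₂ ^ 3 - 27 * g₃ ^ 2)) • ![s, t, u] ^ 4 ≠ 0 :=
    smul_ne_zero hC (pow_ne_zero 4 hx)
  -- Adding the three products raises the exponent 22 of the coefficients to 24. Fourth powers on
  -- the left against quadratic coefficients on the right leave twice the height.
  have := logHeight_le_of_local hy (cons_one_ne_zero ![g₂, g₃]) hx
    (addSub_ne_zero hΔ hx) 24 5 2 1 fun v c h j => by
      have hb := isBounded_addSubCoeff h (one_le_iSup_of_eq_one v (i := 0) (x := ![1, g₂, g₃]) rfl)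
        (iSup_nonneg_abv v ![s, t, u]) (isBounded_coeff g₂ g₃).1 (isBounded_coeff g₂ g₃).2
        (isBounded_coord ![s, t, u] 0) (isBounded_coord ![s, t, u] 1)
        (isBounded_coord ![s, t, u] 2) j
      have hF := apply_le_iSup v (addSub g₂ g₃ s t u)
      have hM := iSup_nonneg_abv v ![1, g₂, g₃]
      have hN := iSup_nonneg_abv v ![s, t, u]
      have hc := h.one_le
      rw [Pi.smul_apply, Pi.pow_apply, smul_eq_mul, addSubCoeff_mul_addSub]
      set B := c ^ 22 * (⨆ i, v (![1, g₂, g₃] i)) ^ 5 * (⨆ i, v (![s, t, u] i)) ^ 2 *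
        ⨆ i, v (addSub g₂ g₃ s t u i) with hB
      have hB0 : 0 ≤ B := mul_nonneg (by positivity) (iSup_nonneg_abv v _)
      have ht : ∀ i, v (addSubCoeff g₂ g₃ s t u j i * addSub g₂ g₃ s t u i) ≤ B := fun i => by
        rw [v.map_mul]
        exact mul_le_mul (hb i) (hF i) (v.nonneg _) (by positivity)
      calc _ ≤ c * (c * B) := h.add_le_of_le (h.add_le_of_le (ht 0) (ht 1))
              ((ht 2).trans (le_mul_of_one_le_left hB0 hc))
        _ = _ := by rw [hB]; ring
  rw [logHeight_smul_eq_logHeight _ hC, logHeight_pow] at this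
  push_cast at this
  linarith

/-- At the origin x has a pole of order 2 and y one of order 3, so 2 h(x : y : 1) and 3 h(x : 1)
agree up to a constant. The curve equation bounds y² by cubes here, and x³ by squares in
`le_logHeight_plane`. -/
theorem logHeight_plane_le {x y : K} (hxy : y ^ 2 = 4 * x ^ 3 - g₂ * x - g₃) :
    2 * logHeight ![x, y, 1] ≤ totalWeight K * (5 * Real.log 2)
      + logHeight ![1, g₂, g₃] + 3 * logHeight ![x, 1] := by
  have hp : ![x, y, 1] ^ 2 ≠ 0 := pow_ne_zero 2 fun h => one_ne_zero (congrFun h 2)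
  have := logHeight_le_of_local hp (cons_one_ne_zero ![g₂, g₃])
    (x := ![x, 1]) (fun h => one_ne_zero (congrFun h 1))
    (z := ![(1 : K)]) (cons_one_ne_zero _) 5 1 3 0 fun v c h j => by
      have hM := one_le_iSup_of_eq_one v (i := 0) (x := ![1, g₂, g₃]) rfl
      have hN := one_le_iSup_of_eq_one v (i := 1) (x := ![x, 1]) rfl
      have h2 := (isBounded_coeff (v := v) (c := c) (N := ⨆ i, v (![x, 1] i)) g₂ g₃).1
      have h3 := (isBounded_coeff (v := v) (c := c) (N := ⨆ i, v (![x, 1] i)) g₂ g₃).2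
      have hx : IsBounded v c (⨆ i, v (![1, g₂, g₃] i)) _ 0 0 1 x := isBounded_coord ![x, 1] 0
      have h1 : IsBounded v c (⨆ i, v (![1, g₂, g₃] i)) _ 0 0 1 (1 : K) :=
        isBounded_coord ![x, 1] 1
      have hN0 := zero_le_one.trans hN
      suffices IsBounded v c _ _ 5 1 3 ((![x, y, 1] ^ 2) j) by simpa [IsBounded] using this
      have hy : IsBounded v c (⨆ i, v (![1, g₂, g₃] i)) (⨆ i, v (![x, 1] i)) 5 1 3 (y ^ 2) := by
        -- The coordinate 1 homogenises all terms to degree 3, since `IsBounded.sub` requires equal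
        -- degrees.
        rw [hxy, show 4 * x ^ 3 - g₂ * x - g₃ = 4 * x ^ 3 - g₂ * x * 1 * 1 - g₃ * 1 ^ 3 by ring]
        refine IsBounded.mono h hM hN0 (((IsBounded.ofNat h 4).mul h hM hN0 (hx.pow h hM hN0 3)).sub
          h hM hN0 (((h2.mul h hM hN0 hx).mul h hM hN0 h1).mul h hM hN0 h1) rfl |>.sub h hM hN0
            (h3.mul h hM hN0 (h1.pow h hM hN0 3)) rfl) ?_ ?_ ?_ <;> decide +kernel
      fin_cases j
      · have : IsBounded v c (⨆ i, v (![1, g₂, g₃] i)) (⨆ i, v (![x, 1] i)) 5 1 3 (x ^ 2 * 1) :=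
          ((hx.pow h hM hN0 2).mul h hM hN0 h1).mono h hM hN0 (by decide) (by decide) rfl
        simpa using this
      · exact hy
      · have := (h1.pow h hM hN0 3).mono h hM hN0 (k' := 5) (m' := 1) (n' := 3) (by decide)
          (by decide) rfl
        simpa using this
  rw [logHeight_pow] at this
  simpa using this

theorem le_logHeight_plane {x y : K} (hxy : y ^ 2 = 4 * x ^ 3 - g₂ * x - g₃) :
    3 * logHeight ![x, 1] ≤ totalWeight K * (5 * Real.log 2)
      + logHeight ![1, g₂, g₃] + 2 * logHeight ![x, y, 1] := by
  have h4 : (4 : K) ≠ 0 := by norm_num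
  have hp : (4 : K) • ![x, 1] ^ 3 ≠ 0 :=
    smul_ne_zero h4 <| pow_ne_zero 3 fun h => one_ne_zero (congrFun h 1)
  have := logHeight_le_of_local hp (cons_one_ne_zero ![g₂, g₃])
    (x := ![x, y, 1]) (fun h => one_ne_zero (congrFun h 2))
    (z := ![(1 : K)]) (cons_one_ne_zero _) 5 1 2 0 fun v c h j => by
      have hM := one_le_iSup_of_eq_one v (i := 0) (x := ![1, g₂, g₃]) rfl
      have hN := one_le_iSup_of_eq_one v (i := 2) (x := ![x, y, 1]) rfl
      have h2 := (isBounded_coeff (v := v) (c := c) (N := ⨆ i, v (![x, y, 1] i)) g₂ g₃).1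
      have h3 := (isBounded_coeff (v := v) (c := c) (N := ⨆ i, v (![x, y, 1] i)) g₂ g₃).2
      have hx : IsBounded v c (⨆ i, v (![1, g₂, g₃] i)) _ 0 0 1 x := isBounded_coord ![x, y, 1] 0
      have hy : IsBounded v c (⨆ i, v (![1, g₂, g₃] i)) _ 0 0 1 y := isBounded_coord ![x, y, 1] 1
      have h1 : IsBounded v c (⨆ i, v (![1, g₂, g₃] i)) _ 0 0 1 (1 : K) :=
        isBounded_coord ![x, y, 1] 2
      have hN0 := zero_le_one.trans hN
      suffices IsBounded v c _ _ 5 1 2 (((4 : K) • ![x, 1] ^ 3) j) by simpa [IsBounded] using this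
      fin_cases j
      · have : IsBounded v c (⨆ i, v (![1, g₂, g₃] i)) (⨆ i, v (![x, y, 1] i)) 5 1 2
            (y ^ 2 + g₂ * x * 1 + g₃ * 1 ^ 2) :=
          ((hy.pow h hM hN0 2).add h hM hN0 ((h2.mul h hM hN0 hx).mul h hM hN0 h1) rfl |>.add
            h hM hN0 (h3.mul h hM hN0 (h1.pow h hM hN0 2)) rfl).mono h hM hN0 (by decide)
            (by decide) rfl
        rw [hxy] at this
        convert this using 1
        simp
        ring
      · have : IsBounded v c (⨆ i, v (![1, g₂, g₃] i)) (⨆ i, v (![x, y, 1] i)) 5 1 2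
            (4 * 1 ^ 2) :=
          ((IsBounded.ofNat h 4).mul h hM hN0 (h1.pow h hM hN0 2)).mono h hM hN0
            (by decide +kernel) (by decide) rfl
        simpa using this
  rw [logHeight_smul_eq_logHeight _ h4, logHeight_pow] at this
  simpa using this

end HeightBounds

/-! ### Canonical heights on abelian groups -/

section Canonical

variable {G : Type*} [AddCommGroup G] {h : G → ℝ} {C : ℝ}

/-- The limit `lim h(2^n P) / 4^n`. -/
def canonicalHeight (h : G → ℝ) (P : G) : ℝ :=
  limUnder atTop fun n : ℕ => h (2 ^ n • P) / 4 ^ n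

variable (h0 : h 0 = 0)
  (hC : ∀ P Q, |h (P + Q) + h (P - Q) - 2 * h P - 2 * h Q| ≤ C)

include h0 hC

/-- Tate's telescoping: the case P = Q of the hypothesis bounds h(2R) - 4h(R) by C. Summing the
geometric series later gives C/3. -/
theorem dist_two_pow_smul_le (P : G) (n : ℕ) :
    Dist.dist (h (2 ^ n • P) / 4 ^ n) (h (2 ^ (n + 1) • P) / 4 ^ (n + 1)) ≤ C / 4 / 4 ^ n := by
  have h4 : (0 : ℝ) < 4 ^ n := by positivity
  have := hC (2 ^ n • P) (2 ^ n • P)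
  rw [sub_self, h0, ← two_nsmul, ← mul_smul, ← pow_succ'] at this
  rw [Real.dist_eq, abs_sub_comm, pow_succ (4 : ℝ),
    show h (2 ^ (n + 1) • P) / (4 ^ n * 4) - h (2 ^ n • P) / 4 ^ n
      = (h (2 ^ (n + 1) • P) + 0 - 2 * h (2 ^ n • P) - 2 * h (2 ^ n • P)) / (4 * 4 ^ n) by
        field_simp; ring,
    abs_div, abs_of_pos (by positivity : (0 : ℝ) < 4 * 4 ^ n), div_div]
  gcongr

theorem cauchySeq_two_pow_smul (P : G) : CauchySeq fun n : ℕ => h (2 ^ n • P) / (4 : ℝ) ^ n := by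
  refine cauchySeq_of_le_geometric (1 / 4) (C / 4) (by norm_num) fun n => ?_
  refine (dist_two_pow_smul_le h0 hC P n).trans_eq ?_
  rw [one_div, inv_pow, div_eq_mul_inv]

theorem tendsto_canonicalHeight (P : G) :
    Tendsto (fun n : ℕ => h (2 ^ n • P) / (4 : ℝ) ^ n) atTop (𝓝 (canonicalHeight h P)) :=
  (cauchySeq_two_pow_smul h0 hC P).tendsto_limUnder

theorem abs_sub_canonicalHeight_le (P : G) : |h P - canonicalHeight h P| ≤ C / 3 := by
  have := dist_le_of_le_geometric_of_tendsto₀ (1 / 4) (C / 4) (by norm_num)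
    (fun n => (dist_two_pow_smul_le h0 hC P n).trans_eq (by rw [one_div, inv_pow, div_eq_mul_inv]))
    (tendsto_canonicalHeight h0 hC P)
  simp only [pow_zero, one_smul, div_one, Real.dist_eq] at this
  exact this.trans_eq (by ring)

theorem canonicalHeight_parallelogram (P Q : G) :
    canonicalHeight h (P + Q) + canonicalHeight h (P - Q)
      = 2 * canonicalHeight h P + 2 * canonicalHeight h Q := by
  have t := fun R => tendsto_canonicalHeight h0 hC R
  have h1 := ((t (P + Q)).add (t (P - Q))).sub (((t P).const_mul 2).add ((t Q).const_mul 2))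
  have h2 : Tendsto (fun n : ℕ => C * (1 / 4 : ℝ) ^ n) atTop (𝓝 0) := by
    simpa using (tendsto_pow_atTop_nhds_zero_of_lt_one (r := (1 / 4 : ℝ)) (by norm_num)
      (by norm_num)).const_mul C
  have h3 := squeeze_zero_norm (fun n => ?_) h2 |> tendsto_nhds_unique h1
  · linarith
  · have h4 : (0 : ℝ) < 4 ^ n := by positivity
    have := hC (2 ^ n • P) (2 ^ n • Q)
    rw [← smul_add, ← smul_sub] at this
    rw [Real.norm_eq_abs, show h (2 ^ n • (P + Q)) / 4 ^ n + h (2 ^ n • (P - Q)) / 4 ^ n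
        - (2 * (h (2 ^ n • P) / 4 ^ n) + 2 * (h (2 ^ n • Q) / 4 ^ n))
      = (h (2 ^ n • (P + Q)) + h (2 ^ n • (P - Q)) - 2 * h (2 ^ n • P) - 2 * h (2 ^ n • Q))
        / 4 ^ n by ring, abs_div, abs_of_pos h4, one_div, inv_pow, ← div_eq_mul_inv]
    gcongr

theorem canonicalHeight_zero : canonicalHeight h (0 : G) = 0 := by
  have := canonicalHeight_parallelogram h0 hC 0 0
  rw [add_zero, sub_zero] at this
  linarith

theorem canonicalHeight_nsmul (P : G) (n : ℕ) :
    canonicalHeight h (n • P) = (n : ℝ) ^ 2 * canonicalHeight h P := by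
  induction n using Nat.twoStepInduction with
  | zero => simp [canonicalHeight_zero h0 hC]
  | one => simp
  | more n ih1 ih2 =>
    have := canonicalHeight_parallelogram h0 hC ((n + 1) • P) P
    rw [← succ_nsmul, show (n + 1) • P - P = n • P by rw [succ_nsmul, add_sub_cancel_right],
      ih1, ih2] at this
    push_cast at this ⊢
    linarith

/-- The limit along powers of 2 is exactly quadratic and differs from h by at most C/3, so dividing
by n² gives convergence along all n. -/
theorem tendsto_div_sq (P : G) :
    Tendsto (fun n : ℕ => h (n • P) / (n : ℝ) ^ 2) atTop (𝓝 (canonicalHeight h P)) := by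
  have h2 : Tendsto (fun n : ℕ => C / 3 / (n : ℝ) ^ 2) atTop (𝓝 0) :=
    ((tendsto_pow_atTop two_ne_zero).comp tendsto_natCast_atTop_atTop).const_div_atTop _
  refine tendsto_iff_dist_tendsto_zero.2 (squeeze_zero' (.of_forall fun _ => dist_nonneg) ?_ h2)
  filter_upwards [eventually_gt_atTop 0] with n hn
  have hn' : (0 : ℝ) < (n : ℝ) ^ 2 := by positivity
  have := abs_sub_canonicalHeight_le h0 hC (n • P)
  rw [canonicalHeight_nsmul h0 hC] at this
  rw [Real.dist_eq, show h (n • P) / (n : ℝ) ^ 2 - canonicalHeight h P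
    = (h (n • P) - (n : ℝ) ^ 2 * canonicalHeight h P) / (n : ℝ) ^ 2 by field_simp,
    abs_div, abs_of_pos hn']
  gcongr

end Canonical

/-! ### The quasi-parallelogram law -/

section Parallelogram

open Height WeierstrassCurve.Affine

variable {K : Type*} [Field K] [NumberField K] {g₂ g₃ : K}

theorem equation_iff_curve {x y : K} :
    (curve g₂ g₃).Equation x y ↔ (2 * y) ^ 2 = 4 * x ^ 3 - g₂ * x - g₃ := by
  rw [WeierstrassCurve.Affine.equation_iff]
  simp only [curve]
  constructor
  · intro h
    linear_combination 4 * h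
  · intro h
    linear_combination h / 4

theorem negY_curve {K : Type*} [Field K] {g₂ g₃ : K} (x y : K) : (curve g₂ g₃).negY x y = -y := by
  simp [WeierstrassCurve.Affine.negY, curve]

variable [DecidableEq K]

/-- The map `addSub` describes the sum and the difference of two points. -/
theorem addSub_sym2x (hΔ : g₂ ^ 3 - 27 * g₃ ^ 2 ≠ 0) (P Q : (curve g₂ g₃).Point) :
    ∃ r : K, r ≠ 0 ∧ addSub g₂ g₃ (P.sym2x Q 0) (P.sym2x Q 1) (P.sym2x Q 2)
      = r • (P + Q).sym2x (P - Q) := by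
  have h16 : (16 : K) ≠ 0 := by norm_num
  rcases P with _ | ⟨x₁, y₁, h₁⟩
  · refine ⟨16, h16, ?_⟩
    rw [← Point.zero_def, zero_add, zero_sub, Point.sym2x_neg_right]
    rcases Q with _ | ⟨x, y, h⟩
    · ext i
      rw [← Point.zero_def]
      fin_cases i <;> simp [addSub]
    · ext i
      fin_cases i <;> simp [addSub] <;> ring
  rcases Q with _ | ⟨x₂, y₂, h₂⟩
  · refine ⟨16, h16, ?_⟩
    rw [← Point.zero_def, add_zero, sub_zero]
    ext i
    fin_cases i <;> simp [addSub] <;> ring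
  have e₁ := equation_iff_curve.1 h₁.1
  have e₂ := equation_iff_curve.1 h₂.1
  have hneg : -Point.some x₂ y₂ h₂ = Point.some x₂ (-y₂)
      (by rw [← negY_curve (g₂ := g₂) (g₃ := g₃) x₂]; exact (nonsingular_neg ..).2 h₂) := by
    simp only [Point.neg_some, negY_curve]
  by_cases hx : x₁ = x₂
  · subst hx
    -- Equal abscissas mean P = Q or P = -Q. One of sum and difference is then zero and the other is
    -- a double, so both cases reduce to the duplication formula.
    have key : ∀ (y : K) (h : (curve g₂ g₃).Nonsingular x₁ y), ∃ r : K, r ≠ 0 ∧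
        addSub g₂ g₃ (x₁ * x₁) (x₁ + x₁) 1 = r •
          (Point.some x₁ y h + Point.some x₁ y h).sym2x (0 : (curve g₂ g₃).Point) := by
      intro y h
      have e := equation_iff_curve.1 h.1
      by_cases hy : y = 0
      · subst hy
        rw [Point.add_self_of_Y_eq (by rw [negY_curve, neg_zero])]
        have hne := addSub_ne_zero hΔ (s := x₁ * x₁) (t := x₁ + x₁) (u := 1)
          (fun h => one_ne_zero (congrFun h 2))
        have a1 : addSub g₂ g₃ (x₁ * x₁) (x₁ + x₁) 1 1 = 0 := by
          simp [addSub]; linear_combination -16 * e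
        have a2 : addSub g₂ g₃ (x₁ * x₁) (x₁ + x₁) 1 2 = 0 := by
          simp [addSub]; ring
        -- For a 2-torsion point the target is (1 : 0 : 0), so the scalar is the only surviving
        -- coordinate of `addSub`.
        refine ⟨addSub g₂ g₃ (x₁ * x₁) (x₁ + x₁) 1 0, fun h0 => hne ?_, ?_⟩
        · ext i; fin_cases i
          · exact h0
          · exact a1
          · exact a2
        · ext i; fin_cases i
          · simp
          · simpa using a1
          · simpa using a2
      · have h2y : y ≠ (curve g₂ g₃).negY x₁ y := by
          rw [negY_curve]
          intro h'
          apply hy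
          have : 2 * y = 0 := by linear_combination h'
          simpa using this
        rw [Point.add_self_of_Y_ne h2y, Point.sym2x_some_zero]
        refine ⟨64 * y ^ 2, by simpa using hy, ?_⟩
        rw [slope_of_Y_ne rfl h2y, negY_curve]
        ext i; fin_cases i
        · have e' : y ^ 2 = (4 * x₁ ^ 3 - g₂ * x₁ - g₃) / 4 := by linear_combination e / 4
          simp only [addSub, addX, curve, Fin.zero_eta, Matrix.cons_val_zero, Pi.smul_apply,
            smul_eq_mul]
          rw [show (64 : K) * y ^ 2 * (((3 * x₁ ^ 2 + 2 * 0 * x₁ + -g₂ / 4 - 0 * y) / (y - -y)) ^ 2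
            + 0 * ((3 * x₁ ^ 2 + 2 * 0 * x₁ + -g₂ / 4 - 0 * y) / (y - -y)) - 0 - x₁ - x₁)
            = 16 * (3 * x₁ ^ 2 - g₂ / 4) ^ 2 - 128 * x₁ * y ^ 2 by
              rw [sub_neg_eq_add, ← two_mul]; field_simp; ring, e']
          ring
        · simp [addSub]
          linear_combination -16 * e
        · simp [addSub]
          ring
    by_cases hy : y₁ = y₂
    · subst hy
      obtain ⟨r, hr, h⟩ := key y₁ h₁
      exact ⟨r, hr, by simpa using h⟩
    · have hy' : y₁ = -y₂ := by
        have : (y₁ - y₂) * (y₁ + y₂) = 0 := by linear_combination (e₁ - e₂) / 4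
        rcases mul_eq_zero.1 this with h | h
        · exact absurd (sub_eq_zero.1 h) hy
        · exact eq_neg_of_add_eq_zero_left h
      subst hy'
      obtain ⟨r, hr, h⟩ := key (-y₂) h₁
      refine ⟨r, hr, ?_⟩
      rw [sub_eq_add_neg (Point.some x₁ _ h₁), hneg, Point.add_of_Y_eq rfl (by rw [negY_curve]), Point.sym2x_comm 0]
      simpa using h
  · have s₁ : y₁ ^ 2 = (4 * x₁ ^ 3 - g₂ * x₁ - g₃) / 4 := by linear_combination e₁ / 4
    have s₂ : y₂ ^ 2 = (4 * x₂ ^ 3 - g₂ * x₂ - g₃) / 4 := by linear_combination e₂ / 4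
    have hxs : x₁ - x₂ ≠ 0 := sub_ne_zero.2 hx
    -- The scalar is read off from the third coordinate 16t² - 64su. Odd powers of y₁ and y₂ cancel
    -- in the symmetric functions, so the curve equations eliminate both ordinates.
    refine ⟨16 * (x₁ - x₂) ^ 2, mul_ne_zero h16 (pow_ne_zero 2 hxs), ?_⟩
    rw [sub_eq_add_neg (Point.some x₁ _ h₁), hneg, Point.add_some (fun h => hx h.1), Point.add_some (fun h => hx h.1),
      Point.sym2x_some_some, Point.sym2x_some_some, slope_of_X_ne hx, slope_of_X_ne hx]
    ext i; fin_cases i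
    · simp only [addSub, addX, curve, Fin.zero_eta, Matrix.cons_val_zero, Pi.smul_apply,
        smul_eq_mul, Matrix.cons_val_one, Matrix.cons_val]
      rw [show 16 * (x₁ - x₂) ^ 2 * ((((y₁ - y₂) / (x₁ - x₂)) ^ 2 + 0 * ((y₁ - y₂) / (x₁ - x₂))
          - 0 - x₁ - x₂) * (((y₁ - -y₂) / (x₁ - x₂)) ^ 2 + 0 * ((y₁ - -y₂) / (x₁ - x₂))
          - 0 - x₁ - x₂)) = 16 * ((y₁ ^ 2 - y₂ ^ 2) ^ 2 - 2 * ((x₁ + x₂) * (x₁ - x₂) ^ 2)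
            * (y₁ ^ 2 + y₂ ^ 2) + ((x₁ + x₂) * (x₁ - x₂) ^ 2) ^ 2) / (x₁ - x₂) ^ 2 by
            field_simp; ring, s₁, s₂, eq_div_iff (pow_ne_zero 2 hxs)]
      ring
    · simp only [addSub, addX, curve, Fin.mk_one, Matrix.cons_val_zero, Pi.smul_apply,
        smul_eq_mul, Matrix.cons_val_one, Matrix.cons_val]
      rw [show 16 * (x₁ - x₂) ^ 2 * ((((y₁ - y₂) / (x₁ - x₂)) ^ 2 + 0 * ((y₁ - y₂) / (x₁ - x₂))
          - 0 - x₁ - x₂) + (((y₁ - -y₂) / (x₁ - x₂)) ^ 2 + 0 * ((y₁ - -y₂) / (x₁ - x₂))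
          - 0 - x₁ - x₂)) = 32 * (y₁ ^ 2 + y₂ ^ 2 - (x₁ + x₂) * (x₁ - x₂) ^ 2) by
            field_simp; ring, s₁, s₂]
      ring
    · simp [addSub]
      ring

end Parallelogram

/-! ### The Néron–Tate height -/

section NeronTate

open Height WeierstrassCurve.Affine

variable {K : Type*} [Field K] [NumberField K] {g₂ g₃ : K}

theorem abs_logHeight_coords_sub_le (P : (curve g₂ g₃).Point) :
    |2 * logHeight (coords g₂ g₃ P) - 3 * logHeight P.xRep| ≤
      totalWeight K * (5 * Real.log 2) + logHeight ![1, g₂, g₃] := by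
  rcases P with _ | ⟨x, y, h⟩
  · have h1 : logHeight (coords g₂ g₃ .zero) = 0 := by simp [coords]
    have h2 : logHeight (Point.zero : (curve g₂ g₃).Point).xRep = 0 := by
      rw [← Point.zero_def]; simp
    rw [h1, h2]
    have := logHeight_nonneg ![1, g₂, g₃]
    have := Real.log_nonneg one_le_two
    simp only [mul_zero, sub_zero, abs_zero]
    positivity
  · have e := equation_iff_curve.1 h.1
    have h1 := logHeight_plane_le e
    have h2 := le_logHeight_plane e
    simp only [coords, Point.xRep_some]
    exact abs_le.2 ⟨by linarith, by linarith⟩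

theorem pointHeight_eq (P : (curve g₂ g₃).Point) :
    pointHeight g₂ g₃ P = logHeight (coords g₂ g₃ P) / totalWeight K := by
  rw [NumberField.totalWeight_eq_finrank]
  rfl

theorem pointHeight_nonneg (P : (curve g₂ g₃).Point) : 0 ≤ pointHeight g₂ g₃ P := by
  rw [pointHeight_eq]
  have := logHeight_nonneg (coords g₂ g₃ P)
  positivity

theorem pointHeight_zero : pointHeight g₂ g₃ 0 = 0 := by
  rw [pointHeight_eq, show coords g₂ g₃ 0 = ![0, 1, 0] from rfl]
  simp

theorem eta_eq : eta g₂ g₃ = logHeight ![1, g₂, g₃] / totalWeight K := by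
  rw [NumberField.totalWeight_eq_finrank]
  rfl

theorem eta_nonneg : 0 ≤ eta g₂ g₃ := by
  rw [eta_eq]
  have := logHeight_nonneg ![1, g₂, g₃]
  positivity

variable [DecidableEq K]

theorem abs_logHeight_xRep_parallelogram_le (hΔ : g₂ ^ 3 - 27 * g₃ ^ 2 ≠ 0)
    (P Q : (curve g₂ g₃).Point) :
    |logHeight (P + Q).xRep + logHeight (P - Q).xRep - 2 * logHeight P.xRep
      - 2 * logHeight Q.xRep| ≤ totalWeight K * (27 * Real.log 2) + 5 * logHeight ![1, g₂, g₃] := by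
  have e : ∀ R : (curve g₂ g₃).Point, R.xRep = ![R.xRep 0, R.xRep 1] := fun R => by
    ext i; fin_cases i <;> rfl
  have hne : ∀ R : (curve g₂ g₃).Point, ![R.xRep 0, R.xRep 1] ≠ 0 := fun R => by
    rw [← e]; exact R.xRep_ne_zero
  have up : ∀ R T : (curve g₂ g₃).Point, logHeight (R.sym2x T) ≤
      totalWeight K * Real.log 2 + logHeight R.xRep + logHeight T.xRep := fun R T => by
    rw [e R, e T]
    exact logHeight_sym2_le_explicit (hne R) (hne T) (R.sym2x_ne_zero T)
  have low : ∀ R T : (curve g₂ g₃).Point, logHeight R.xRep + logHeight T.xRep ≤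
      totalWeight K * Real.log 2 + logHeight (R.sym2x T) := fun R T => by
    rw [e R, e T]
    exact le_logHeight_sym2 (hne R) (hne T) (R.sym2x_ne_zero T)
  obtain ⟨r, hr, hF⟩ := addSub_sym2x hΔ P Q
  have es : P.sym2x Q = ![P.sym2x Q 0, P.sym2x Q 1, P.sym2x Q 2] := by
    ext i; fin_cases i <;> rfl
  have hs : ![P.sym2x Q 0, P.sym2x Q 1, P.sym2x Q 2] ≠ 0 := by
    rw [← es]; exact P.sym2x_ne_zero Q
  have h1 := logHeight_addSub_le hΔ hs
  have h2 := logHeight_le_addSub hΔ hs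
  rw [hF, logHeight_smul_eq_logHeight _ hr, ← es] at h1 h2
  have := up P Q
  have := low P Q
  have := up (P + Q) (P - Q)
  have := low (P + Q) (P - Q)
  have := logHeight_nonneg ![1, g₂, g₃]
  have : 0 ≤ totalWeight K * Real.log 2 := by
    have := Real.log_nonneg one_le_two
    positivity
  -- The lower estimate is the worse one: 24 from the elimination identity, 2 from the pair P, Q
  -- taken twice, and 1 from the pair P + Q, P - Q make 27.
  exact abs_le.2 ⟨by linarith, by linarith⟩

theorem abs_pointHeight_parallelogram_le (hΔ : g₂ ^ 3 - 27 * g₃ ^ 2 ≠ 0)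
    (P Q : (curve g₂ g₃).Point) :
    |pointHeight g₂ g₃ (P + Q) + pointHeight g₂ g₃ (P - Q) - 2 * pointHeight g₂ g₃ P
      - 2 * pointHeight g₂ g₃ Q| ≤ 56 * Real.log 2 + 11 * eta g₂ g₃ := by
  have hd : (0 : ℝ) < totalWeight K := by exact_mod_cast NumberField.totalWeight_pos K
  have hl := Real.log_nonneg one_le_two
  have hg := logHeight_nonneg ![1, g₂, g₃]
  have hdl : 0 ≤ totalWeight K * Real.log 2 := by positivity
  have h1 := abs_le.1 (abs_logHeight_coords_sub_le (P + Q))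
  have h2 := abs_le.1 (abs_logHeight_coords_sub_le (P - Q))
  have h3 := abs_le.1 (abs_logHeight_coords_sub_le P)
  have h4 := abs_le.1 (abs_logHeight_coords_sub_le Q)
  have h5 := abs_le.1 (abs_logHeight_xRep_parallelogram_le hΔ P Q)
  simp only [pointHeight_eq, eta_eq]
  rw [show logHeight (coords g₂ g₃ (P + Q)) / totalWeight K
      + logHeight (coords g₂ g₃ (P - Q)) / totalWeight K
      - 2 * (logHeight (coords g₂ g₃ P) / totalWeight K)
      - 2 * (logHeight (coords g₂ g₃ Q) / totalWeight K)
      = (logHeight (coords g₂ g₃ (P + Q)) + logHeight (coords g₂ g₃ (P - Q))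
        - 2 * logHeight (coords g₂ g₃ P) - 2 * logHeight (coords g₂ g₃ Q)) / totalWeight K by ring,
    show 56 * Real.log 2 + 11 * (logHeight ![1, g₂, g₃] / totalWeight K)
      = (56 * (totalWeight K * Real.log 2) + 11 * logHeight ![1, g₂, g₃]) / totalWeight K by
        field_simp, abs_div, abs_of_pos hd]
  gcongr
  -- Twice the defect is at most 3(27 log 2 + 5η) + 6(5 log 2 + η) = 111 log 2 + 21η; halves are
  -- rounded up.
  exact abs_le.2 ⟨by linarith, by linarith⟩

/-- The defining limit exists, so `limUnder` takes no junk value here. -/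
theorem neronTate_eq (hΔ : g₂ ^ 3 - 27 * g₃ ^ 2 ≠ 0) (P : (curve g₂ g₃).Point) :
    neronTate g₂ g₃ P = canonicalHeight (pointHeight g₂ g₃) P := by
  have h := tendsto_div_sq (G := (curve g₂ g₃).Point) (h := pointHeight g₂ g₃) pointHeight_zero
    (C := 56 * Real.log 2 + 11 * eta g₂ g₃) (abs_pointHeight_parallelogram_le hΔ) P
  exact h.limUnder_eq

theorem neronTate_parallelogram (hΔ : g₂ ^ 3 - 27 * g₃ ^ 2 ≠ 0) (P Q : (curve g₂ g₃).Point) :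
    neronTate g₂ g₃ (P + Q) + neronTate g₂ g₃ (P - Q)
      = 2 * neronTate g₂ g₃ P + 2 * neronTate g₂ g₃ Q := by
  simp only [neronTate_eq hΔ]
  exact canonicalHeight_parallelogram (G := (curve g₂ g₃).Point) (h := pointHeight g₂ g₃)
    (C := 56 * Real.log 2 + 11 * eta g₂ g₃) pointHeight_zero (abs_pointHeight_parallelogram_le hΔ) P Q

theorem abs_pointHeight_sub_neronTate_le (hΔ : g₂ ^ 3 - 27 * g₃ ^ 2 ≠ 0)
    (P : (curve g₂ g₃).Point) :
    |pointHeight g₂ g₃ P - neronTate g₂ g₃ P| ≤ 18 * eta g₂ g₃ + 68 := by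
  rw [neronTate_eq hΔ]
  have := abs_sub_canonicalHeight_le (G := (curve g₂ g₃).Point) (h := pointHeight g₂ g₃)
    (C := 56 * Real.log 2 + 11 * eta g₂ g₃) pointHeight_zero (abs_pointHeight_parallelogram_le hΔ) P
  have := Real.log_two_lt_d9
  have := eta_nonneg (g₂ := g₂) (g₃ := g₃)
  linarith

theorem neronTate_zero (hΔ : g₂ ^ 3 - 27 * g₃ ^ 2 ≠ 0) : neronTate g₂ g₃ 0 = 0 := by
  rw [neronTate_eq hΔ]
  exact canonicalHeight_zero (G := (curve g₂ g₃).Point) (h := pointHeight g₂ g₃)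
    (C := 56 * Real.log 2 + 11 * eta g₂ g₃) pointHeight_zero (abs_pointHeight_parallelogram_le hΔ)

end NeronTate

/-! ### The group law near the origin -/

section Chord

variable {K : Type*} [Field K]

/-! ### Absorbing constants into powers of a small δ. -/

namespace IsBounded

variable {f : K → ℝ} {c M δ : ℝ} {k m n k' m' n' : ℕ} {a b : K}

theorem mono_of_le_one (h : IsQuasiAbs f c) (hM : 1 ≤ M) (hδ : 0 ≤ δ) (hδ1 : δ ≤ 1)
    (ha : IsBounded f c M δ k m n a) (hk : k ≤ k') (hm : m ≤ m') (hn : n' ≤ n) :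
    IsBounded f c M δ k' m' n' a := by
  have := h.one_le
  refine (ha.mono h hM hδ hk hm rfl).trans ?_
  have := pow_le_pow_of_le_one hδ hδ1 hn
  gcongr

/-- Every surplus factor δ pays for 23 factors c and 2 factors M. -/
theorem apply_le (h : IsQuasiAbs f c) (hM : 1 ≤ M) (hδ : 0 ≤ δ) (hsmall : c ^ 23 * M ^ 2 * δ < 1)
    (ha : IsBounded f c M δ k m (n + 1) a) (hk : k ≤ 23 * n) (hm : m ≤ 2 * n) : f a ≤ δ := by
  have hc := h.one_le
  refine (ha.mono h hM hδ hk hm rfl).trans ?_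
  calc c ^ (23 * n) * M ^ (2 * n) * δ ^ (n + 1) = (c ^ 23 * M ^ 2 * δ) ^ n * δ := by
        rw [mul_pow, mul_pow, pow_mul, pow_mul, pow_succ]; ring
    _ ≤ 1 * δ := by gcongr; exact pow_le_one₀ (by positivity) hsmall.le
    _ = δ := one_mul δ

theorem mul_apply_lt_one (h : IsQuasiAbs f c) (hM : 1 ≤ M) (hδ : 0 ≤ δ)
    (hsmall : c ^ 23 * M ^ 2 * δ < 1) (ha : IsBounded f c M δ k m (n + 1) a)
    (hk : k ≤ 22 + 23 * n) (hm : m ≤ 2 + 2 * n) : c * f a < 1 := by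
  have hc := h.one_le
  have h1 := ha.mono h hM hδ hk hm rfl
  calc c * f a ≤ c * (c ^ (22 + 23 * n) * M ^ (2 + 2 * n) * δ ^ (n + 1)) :=
        mul_le_mul_of_nonneg_left h1 h.c_pos.le
    _ = (c ^ 23 * M ^ 2 * δ) ^ n * (c ^ 23 * M ^ 2 * δ) := by
        rw [mul_pow, mul_pow, pow_add, pow_add, pow_mul, pow_mul, pow_succ]; ring
    _ ≤ 1 * (c ^ 23 * M ^ 2 * δ) := by gcongr; exact pow_le_one₀ (by positivity) hsmall.le
    _ < 1 := by rwa [one_mul]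

theorem of_mul_one_add (h : IsQuasiAbs f c) (hab : IsBounded f c M δ k m n (a * (1 + b)))
    (hb : c * f b < 1) : IsBounded f c M δ (k + 1) m n a := by
  unfold IsBounded at *
  rw [h.mul] at hab
  calc f a ≤ f a * (c * f (1 + b)) :=
        le_mul_of_one_le_right (h.nonneg a) (h.one_le_mul_one_add hb)
    _ = c * (f a * f (1 + b)) := by ring
    _ ≤ c * (c ^ k * M ^ m * δ ^ n) := mul_le_mul_of_nonneg_left hab h.c_pos.le
    _ = _ := by ring

end IsBounded

variable [CharZero K]

/-- The coordinates `x / (2 y)` and `1 / (2 y)` of the third intersection point of the curve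
`(2 y)² = 4 x³ - g₂ x - g₃` with the line `y = L x + N` through two points close to the origin. -/
theorem chord_bound {f : K → ℝ} {c M δ : ℝ} (h : IsQuasiAbs f c) (hM : 1 ≤ M) (hδ : 0 ≤ δ)
    (hsmall : c ^ 23 * M ^ 2 * δ < 1) {g₂ g₃ x₁ x₂ x₃ L N : K} (hg₂ : f g₂ ≤ M) (hg₃ : f g₃ ≤ M)
    (hy₁ : L * x₁ + N ≠ 0) (hy₂ : L * x₂ + N ≠ 0) (e₁ : x₃ = L ^ 2 - x₁ - x₂)
    (e₂ : x₁ * x₂ + (x₁ + x₂) * x₃ = -g₂ / 4 - 2 * L * N) (e₃ : x₁ * x₂ * x₃ = N ^ 2 + g₃ / 4)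
    (ht₁ : f (x₁ / (2 * (L * x₁ + N))) ≤ δ) (ht₂ : f (x₂ / (2 * (L * x₂ + N))) ≤ δ)
    (hw₁ : f (1 / (2 * (L * x₁ + N))) ≤ δ) (hw₂ : f (1 / (2 * (L * x₂ + N))) ≤ δ) :
    L * x₃ + N ≠ 0 ∧ f (x₃ / (2 * (L * x₃ + N))) ≤ c ^ 2 * δ ∧
      f (1 / (2 * (L * x₃ + N))) ≤ δ := by
  have hc := h.one_le
  have hδ1 : δ ≤ 1 := by
    refine le_trans ?_ hsmall.le
    have : 1 ≤ c ^ 23 * M ^ 2 := one_le_mul_of_one_le_of_one_le (one_le_pow₀ hc) (one_le_pow₀ hM)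
    exact le_mul_of_one_le_left hδ this
  have b2 : IsBounded f c M δ 0 1 0 g₂ := by simpa [IsBounded] using hg₂
  have b3 : IsBounded f c M δ 0 1 0 g₃ := by simpa [IsBounded] using hg₃
  have hg2 : g₂ = -4 * (x₁ * x₂ + (x₁ + x₂) * x₃ + 2 * L * N) := by
    rw [e₂]; ring
  have hg3 : g₃ = 4 * (x₁ * x₂ * x₃ - N ^ 2) := by rw [e₃]; ring
  -- With t = x/(2y) and w = 1/(8y) the curve becomes w(1 + 4g₂tw + 16g₃w²) = t³ near the origin, so
  -- w has order t³.
  have small : ∀ {x : K}, L * x + N ≠ 0 → (2 * (L * x + N)) ^ 2 = 4 * x ^ 3 - g₂ * x - g₃ →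
      f (x / (2 * (L * x + N))) ≤ δ → f (1 / (2 * (L * x + N))) ≤ δ →
      IsBounded f c M δ 1 0 3 (1 / (8 * (L * x + N))) := by
    intro x hy e ht hw
    have bt : IsBounded f c M δ 0 0 1 (x / (2 * (L * x + N))) := by simpa [IsBounded] using ht
    have bw : IsBounded f c M δ 0 0 1 (1 / (2 * (L * x + N))) := by simpa [IsBounded] using hw
    have bE : IsBounded f c M δ 1 1 (1 + 1) (g₂ * (x / (2 * (L * x + N))) * (1 / (2 * (L * x + N)))
        + g₃ * (1 / (2 * (L * x + N))) ^ 2) :=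
      ((b2.mul h hM hδ bt).mul h hM hδ bw).add h hM hδ (b3.mul h hM hδ (bw.pow h hM hδ 2)) rfl
    refine IsBounded.of_mul_one_add h (b := g₂ * (x / (2 * (L * x + N))) * (1 / (2 * (L * x + N)))
        + g₃ * (1 / (2 * (L * x + N))) ^ 2) ?_
      (bE.mul_apply_lt_one h hM hδ hsmall (by norm_num) (by norm_num))
    have : 1 / (8 * (L * x + N)) * (1 + (g₂ * (x / (2 * (L * x + N))) * (1 / (2 * (L * x + N)))
        + g₃ * (1 / (2 * (L * x + N))) ^ 2)) = (x / (2 * (L * x + N))) ^ 3 := by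
      generalize L * x + N = y at *
      field_simp
      linear_combination 2 * e
    rw [this]
    exact bt.pow h hM hδ 3
  have c₁ : (2 * (L * x₁ + N)) ^ 2 = 4 * x₁ ^ 3 - g₂ * x₁ - g₃ := by
    rw [hg2, hg3, e₁]; ring
  have c₂ : (2 * (L * x₂ + N)) ^ 2 = 4 * x₂ ^ 3 - g₂ * x₂ - g₃ := by
    rw [hg2, hg3, e₁]; ring
  have bw₁ := small hy₁ c₁ ht₁ hw₁
  have bw₂ := small hy₂ c₂ ht₂ hw₂
  have bt₁ : IsBounded f c M δ 0 0 1 (x₁ / (2 * (L * x₁ + N))) := by simpa [IsBounded] using ht₁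
  have bt₂ : IsBounded f c M δ 0 0 1 (x₂ / (2 * (L * x₂ + N))) := by simpa [IsBounded] using ht₂
  -- In these coordinates the line is w = lt + ν with l = -L/(4N) and ν = 1/(8N). This is the
  -- divided difference of the curve equation for l, multiplied by -4N: it needs neither t₁ ≠ t₂, so
  -- tangents are included, nor N ≠ 0.
  have dd : L * (1 + (4 * g₂ * (x₁ / (2 * (L * x₁ + N)))
        * (1 / (8 * (L * x₁ + N)) + 1 / (8 * (L * x₂ + N)))
      + 16 * g₃ * ((1 / (8 * (L * x₁ + N))) ^ 2 + (1 / (8 * (L * x₁ + N))) * (1 / (8 * (L * x₂ + N)))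
        + (1 / (8 * (L * x₂ + N))) ^ 2)))
      = -4 * N * ((x₁ / (2 * (L * x₁ + N))) ^ 2
        + (x₁ / (2 * (L * x₁ + N))) * (x₂ / (2 * (L * x₂ + N))) + (x₂ / (2 * (L * x₂ + N))) ^ 2
        - 4 * g₂ * (1 / (8 * (L * x₂ + N))) ^ 2) := by
    rw [hg2, hg3, e₁]
    field_simp
    ring
  have hpos3 : ((L * x₁ + N) * (L * x₂ + N) * (L * x₃ + N))
      = N ^ 3 - g₂ / 4 * L ^ 2 * N + g₃ / 4 * L ^ 3 := by
    rw [hg2, hg3, e₁]; ring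
  -- Vieta for the cubic in t obtained by inserting w = lt + ν. Its leading coefficient 1 - 4g₂l² -
  -- 16g₃l³ equals y₁y₂y₃/N³, where y_i = Lx_i + N.
  have tsum : ∀ (hN : N ≠ 0) (h₃ : L * x₃ + N ≠ 0),
      (x₁ / (2 * (L * x₁ + N)) + x₂ / (2 * (L * x₂ + N)) + x₃ / (2 * (L * x₃ + N)))
        * (1 + (-(4 * g₂ * (-L / (4 * N)) ^ 2) - 16 * g₃ * (-L / (4 * N)) ^ 3))
      = 1 / (8 * N) * (8 * g₂ * (-L / (4 * N)) + 48 * g₃ * (-L / (4 * N)) ^ 2) := by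
    intro hN h₃
    have hA : 1 + (-(4 * g₂ * (-L / (4 * N)) ^ 2) - 16 * g₃ * (-L / (4 * N)) ^ 3)
        = (L * x₁ + N) * (L * x₂ + N) * (L * x₃ + N) / N ^ 3 := by
      rw [hpos3]; field_simp; ring
    have clear_denom : ∀ y₁ y₂ y₃ : K, y₁ ≠ 0 → y₂ ≠ 0 → y₃ ≠ 0 →
        (x₁ / (2 * y₁) + x₂ / (2 * y₂) + x₃ / (2 * y₃)) * (y₁ * y₂ * y₃ / N ^ 3)
          = (x₁ * y₂ * y₃ + x₂ * y₁ * y₃ + x₃ * y₁ * y₂) / (2 * N ^ 3) := by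
      intro y₁ y₂ y₃ _ _ _
      field_simp
    rw [hA, clear_denom _ _ _ hy₁ hy₂ h₃, hg2, hg3, e₁]
    field_simp
    ring
  have hν : ∀ hN : N ≠ 0, 1 / (8 * N) = 1 / (8 * (L * x₁ + N))
      - -L / (4 * N) * (x₁ / (2 * (L * x₁ + N))) := by
    intro hN; field_simp; ring
  have hw₃ : ∀ (hN : N ≠ 0) (h₃ : L * x₃ + N ≠ 0), 1 / (2 * (L * x₃ + N))
      = 4 * (-L / (4 * N) * (x₃ / (2 * (L * x₃ + N))) + 1 / (8 * N)) := by
    intro hN h₃; field_simp; ring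
  generalize x₁ / (2 * (L * x₁ + N)) = t₁ at *
  generalize x₂ / (2 * (L * x₂ + N)) = t₂ at *
  generalize 1 / (8 * (L * x₁ + N)) = w₁ at *
  generalize 1 / (8 * (L * x₂ + N)) = w₂ at *
  have b4 : IsBounded f c M δ 3 0 0 (4 : K) := IsBounded.ofNat h 4
  have b8 : IsBounded f c M δ 4 0 0 (8 : K) := IsBounded.ofNat h 8
  have b16 : IsBounded f c M δ 5 0 0 (16 : K) := IsBounded.ofNat h 16
  have b48 : IsBounded f c M δ 6 0 0 (48 : K) := IsBounded.ofNat h 48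
  have bD : IsBounded f c M δ 10 1 (3 + 1) (4 * g₂ * t₁ * (w₁ + w₂)
      + 16 * g₃ * (w₁ ^ 2 + w₁ * w₂ + w₂ ^ 2)) := by
    have i1 := ((b4.mul h hM hδ b2).mul h hM hδ bt₁).mul h hM hδ (bw₁.add h hM hδ bw₂ rfl)
    have i2 := (b16.mul h hM hδ b3).mul h hM hδ ((bw₁.pow h hM hδ 2).add h hM hδ
      (bw₁.mul h hM hδ bw₂) rfl |>.add h hM hδ (bw₂.pow h hM hδ 2) rfl)
    exact (i1.add h hM hδ (i2.mono_of_le_one h hM hδ hδ1 le_rfl le_rfl (by norm_num)) rfl).mono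
      h hM hδ (by norm_num) (by norm_num) rfl
  have hcD := bD.mul_apply_lt_one h hM hδ hsmall (by norm_num) (by norm_num)
  -- For N = 0 the divided difference identity forces L = 0, since its second factor is a unit close
  -- to 1; then y₁ would vanish.
  have hN : N ≠ 0 := by
    rintro rfl
    have hD := h.one_le_mul_one_add hcD
    have hL : L = 0 := by
      rw [mul_zero, zero_mul] at dd
      refine (mul_eq_zero.1 dd).resolve_right fun h0 => ?_
      rw [h0, h.zero] at hD
      linarith
    simp [hL] at hy₁
  have bL : IsBounded f c M δ 8 1 2 (-L / (4 * N)) := by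
    refine IsBounded.mono h hM hδ (k := 7 + 1) (IsBounded.of_mul_one_add h ?_ hcD) (by norm_num)
      le_rfl rfl
    rw [show -L / (4 * N) * (1 + (4 * g₂ * t₁ * (w₁ + w₂)
        + 16 * g₃ * (w₁ ^ 2 + w₁ * w₂ + w₂ ^ 2))) = t₁ ^ 2 + t₁ * t₂ + t₂ ^ 2 - 4 * g₂ * w₂ ^ 2 by
          rw [div_mul_eq_mul_div, neg_mul, dd]; field_simp]
    have i1 := (bt₁.pow h hM hδ 2).add h hM hδ (bt₁.mul h hM hδ bt₂) rfl |>.add h hM hδ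
      (bt₂.pow h hM hδ 2) rfl
    have i2 := (b4.mul h hM hδ b2).mul h hM hδ (bw₂.pow h hM hδ 2)
    exact (i1.sub h hM hδ (i2.mono_of_le_one h hM hδ hδ1 le_rfl le_rfl (by norm_num)) rfl).mono
      h hM hδ (by norm_num) (by norm_num) rfl
  have bν : IsBounded f c M δ 9 1 3 (1 / (8 * N)) := by
    rw [hν hN]
    exact (bw₁.sub h hM hδ (bL.mul h hM hδ bt₁) rfl).mono h hM hδ (by norm_num) (by norm_num) rfl
  have hA : 1 + (-(4 * g₂ * (-L / (4 * N)) ^ 2) - 16 * g₃ * (-L / (4 * N)) ^ 3)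
      = (L * x₁ + N) * (L * x₂ + N) * (L * x₃ + N) / N ^ 3 := by
    rw [hpos3]; field_simp; ring
  have tsum' := tsum hN
  have hw₃' := hw₃ hN
  generalize -L / (4 * N) = l at *
  generalize 1 / (8 * N) = ν at *
  have bA : IsBounded f c M δ 30 4 (3 + 1) (-(4 * g₂ * l ^ 2) - 16 * g₃ * l ^ 3) := by
    have i1 := ((b4.mul h hM hδ b2).mul h hM hδ (bL.pow h hM hδ 2)).neg h
    have i2 := (b16.mul h hM hδ b3).mul h hM hδ (bL.pow h hM hδ 3)
    exact (i1.sub h hM hδ (i2.mono_of_le_one h hM hδ hδ1 le_rfl le_rfl (by norm_num)) rfl).mono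
      h hM hδ (by norm_num) (by norm_num) rfl
  have hcA := bA.mul_apply_lt_one h hM hδ hsmall (by norm_num) (by norm_num)
  have hy₃ : L * x₃ + N ≠ 0 := by
    intro h0
    have := h.one_le_mul_one_add hcA
    rw [hA, h0, mul_zero, zero_div, h.zero] at this
    linarith
  refine ⟨hy₃, ?_⟩
  -- The group law is additive in t up to order δ⁵. Hence t₃ is -(t₁ + t₂) up to a negligible term,
  -- and two additions cost c².
  have bsum : IsBounded f c M δ 40 4 (4 + 1) (t₁ + t₂ + x₃ / (2 * (L * x₃ + N))) := by
    refine IsBounded.mono h hM hδ (IsBounded.of_mul_one_add h (k := 36) ?_ hcA) (by norm_num)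
      le_rfl rfl
    rw [tsum' hy₃]
    have i1 := (b8.mul h hM hδ b2).mul h hM hδ bL
    have i2 := (b48.mul h hM hδ b3).mul h hM hδ (bL.pow h hM hδ 2)
    exact (bν.mul h hM hδ (i1.add h hM hδ (i2.mono_of_le_one h hM hδ hδ1 le_rfl le_rfl
      (by norm_num)) rfl)).mono h hM hδ (by norm_num) (by norm_num) rfl
  have bt₃ : f (x₃ / (2 * (L * x₃ + N))) ≤ c ^ 2 * δ := by
    rw [show x₃ / (2 * (L * x₃ + N)) = (t₁ + t₂ + x₃ / (2 * (L * x₃ + N))) + -(t₁ + t₂) by ring,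
      sq, mul_assoc]
    refine h.add_le_of_le ((bsum.apply_le h hM hδ hsmall (by norm_num) (by norm_num)).trans
      (le_mul_of_one_le_left hδ hc)) ?_
    rw [h.neg]
    exact h.add_le_of_le ht₁ ht₂
  refine ⟨bt₃, ?_⟩
  rw [hw₃' hy₃]
  have bt₃' : IsBounded f c M δ 2 0 1 (x₃ / (2 * (L * x₃ + N))) := by simpa [IsBounded] using bt₃
  exact (b4.mul h hM hδ ((bL.mul h hM hδ bt₃').add h hM hδ bν rfl)).apply_le (n := 2) h hM hδ
    hsmall (by norm_num) (by norm_num)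

end Chord

/-! ### Local distances on the curve -/

section LocalDistance

open WeierstrassCurve.Affine

variable {K : Type*} [Field K] [NumberField K]

/-- The constant in the quasi-ultrametric inequality for `absV v`. -/
def quasiConst : Place K → ℝ
  | .inl _ => 2
  | .inr _ => 1

theorem isQuasiAbs_absV {v : Place K} (hv : localDegree v ≠ 0) :
    IsQuasiAbs (absV v) (quasiConst v) := by
  rcases v with v | v
  · exact IsQuasiAbs.of_absoluteValue v.1
  · have hp : 0 < 1 / (localDegree (.inr v : Place K) : ℝ) :=
      one_div_pos.2 (by exact_mod_cast Nat.pos_of_ne_zero hv)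
    refine ⟨le_rfl, absV_nonneg _, ?_, ?_, ?_, absV_mul _, fun a b => ?_⟩
    · simp only [absV, map_zero]
      exact Real.zero_rpow hp.ne'
    · simp only [absV, map_one]
      exact Real.one_rpow _
    · simp [absV, map_neg_eq_map]
    · simp only [absV, quasiConst, one_mul]
      have hm := Real.monotoneOn_rpow_Ici_of_exponent_nonneg hp.le
      rw [← hm.map_max (apply_nonneg v a) (apply_nonneg v b)]
      exact hm (apply_nonneg v _) (le_max_of_le_left (apply_nonneg v a)) (FinitePlace.add_le v a b)

/-- A `finrank` could be 0 by default. Then the exponent 1/0 is 0 and all distances are 1, which the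
closeness hypotheses exclude; finiteness of the local extension is never needed. -/
theorem absV_eq_one {v : Place K} (hv : localDegree v = 0) (x : K) : absV v x = 1 := by
  rcases v with v | v
  · exact absurd hv v.mult_ne_zero
  · simp [absV, hv]

theorem mConst_nonneg (g₂ g₃ : K) (v : Place K) : 0 ≤ mConst g₂ g₃ v :=
  Real.log_nonneg (le_max_left _ _)

theorem cConst_nonneg (v : Place K) : 0 ≤ cConst v := by
  rcases v with v | v <;> norm_num [cConst]

variable {g₂ g₃ : K} {v : Place K}

theorem distZero_eq_distCoord (P : (curve g₂ g₃).Point) :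
    distZero g₂ g₃ v P = distCoord v (coords g₂ g₃ P) ![0, 1, 0] :=
  dist_mk v _ _

theorem distZero_of_localDegree_eq_zero (hv : localDegree v = 0) (P : (curve g₂ g₃).Point) :
    distZero g₂ g₃ v P = 1 := by
  rw [distZero_eq_distCoord]
  simp [distCoord, max3, absV_eq_one hv]

theorem distZero_zero (hv : localDegree v ≠ 0) : distZero g₂ g₃ v 0 = 0 := by
  rw [distZero_eq_distCoord, show coords g₂ g₃ 0 = ![0, 1, 0] from rfl]
  simp [distCoord, max3, (isQuasiAbs_absV hv).zero]

theorem distZero_some (hv : localDegree v ≠ 0) {x y : K} (h : (curve g₂ g₃).Nonsingular x y) :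
    distZero g₂ g₃ v (.some x y h)
      = max (absV v x) 1 / max (absV v x) (max (absV v (2 * y)) 1) := by
  have hq := isQuasiAbs_absV hv
  rw [distZero_eq_distCoord]
  simp [coords, distCoord, max3, hq.zero, hq.one, hq.neg]

theorem distZero_nonneg (P : (curve g₂ g₃).Point) : 0 ≤ distZero g₂ g₃ v P := by
  rw [distZero_eq_distCoord, distCoord]
  have : ∀ a b c : K, 0 ≤ max3 v a b c := fun a b c => le_max_of_le_left (absV_nonneg v a)
  exact div_nonneg (this _ _ _) (mul_nonneg (this _ _ _) (this _ _ _))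

theorem distZero_neg (hv : localDegree v ≠ 0) (P : (curve g₂ g₃).Point) :
    distZero g₂ g₃ v (-P) = distZero g₂ g₃ v P := by
  rcases P with _ | ⟨x, y, h⟩
  · rfl
  · rw [Point.neg_some, distZero_some hv, distZero_some hv, negY_curve, mul_neg,
      (isQuasiAbs_absV hv).neg]

/-- A distance below 1 forces 2y to be the dominant coordinate, so the distance is the larger of the
sizes of x/(2y) and 1/(2y). -/
theorem bounds_of_distZero_some_le (hv : localDegree v ≠ 0) {x y : K}
    {h : (curve g₂ g₃).Nonsingular x y} {δ : ℝ} (hδ : δ < 1)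
    (hd : distZero g₂ g₃ v (.some x y h) ≤ δ) :
    y ≠ 0 ∧ absV v (x / (2 * y)) ≤ δ ∧ absV v (1 / (2 * y)) ≤ δ := by
  have hq := isQuasiAbs_absV hv
  rw [distZero_some hv] at hd
  have hD : 0 < max (absV v x) (max (absV v (2 * y)) 1) := by positivity
  rw [div_le_iff₀ hD] at hd
  have hlt := hd.trans_lt (mul_lt_of_lt_one_left hD hδ)
  have hD' : max (absV v x) (max (absV v (2 * y)) 1) = absV v (2 * y) := by
    rcases max_choice (absV v x) (max (absV v (2 * y)) 1) with e | e
    · rw [e] at hlt; exact absurd (le_max_left _ _) hlt.not_ge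
    · rcases max_choice (absV v (2 * y)) 1 with e' | e'
      · rw [e, e']
      · rw [e, e'] at hlt; exact absurd (le_max_right _ _) hlt.not_ge
  rw [hD'] at hD hd
  have hy : 2 * y ≠ 0 := by
    intro h0
    rw [h0, hq.zero] at hD
    exact lt_irrefl _ hD
  refine ⟨right_ne_zero_of_mul hy, ?_, ?_⟩
  · rw [hq.div _ hy, div_le_iff₀ hD]
    exact (le_max_left _ _).trans hd
  · rw [hq.div _ hy, div_le_iff₀ hD, hq.one]
    exact (le_max_right _ _).trans hd

theorem distZero_some_le (hv : localDegree v ≠ 0) {x y : K}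
    {h : (curve g₂ g₃).Nonsingular x y} {δ : ℝ} (hy : y ≠ 0)
    (hx : absV v (x / (2 * y)) ≤ δ) (h1 : absV v (1 / (2 * y)) ≤ δ) :
    distZero g₂ g₃ v (.some x y h) ≤ δ := by
  have hq := isQuasiAbs_absV hv
  have hy2 : 2 * y ≠ 0 := mul_ne_zero two_ne_zero hy
  have hD := hq.pos hy2
  have hδ : 0 ≤ δ := (absV_nonneg _ _).trans hx
  rw [hq.div _ hy2, div_le_iff₀ hD] at hx h1
  rw [hq.one] at h1
  rw [distZero_some hv, div_le_iff₀ (by positivity)]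
  refine (max_le hx h1).trans (mul_le_mul_of_nonneg_left ?_ hδ)
  exact (le_max_left _ _).trans (le_max_right _ _)

/-- The origin of the exponent 23: it is the largest one with 2 ^ 23 ≤ e ^ 16. -/
theorem quasiConst_pow_le (v : Place K) : quasiConst v ^ 23 ≤ Real.exp (cConst v) := by
  rcases v with v | v
  · simp only [quasiConst, cConst]
    rw [show (16 : ℝ) = (16 : ℕ) * 1 by norm_num, Real.exp_nat_mul]
    refine le_trans ?_ (pow_le_pow_left₀ (by norm_num) Real.exp_one_gt_d9.le 16)
    norm_num
  · simp [quasiConst, cConst]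

variable [DecidableEq K]

theorem distZero_add_le (hv : localDegree v ≠ 0) {P Q : (curve g₂ g₃).Point} {M δ : ℝ}
    (hM : 1 ≤ M) (hg₂ : absV v g₂ ≤ M) (hg₃ : absV v g₃ ≤ M)
    (hsmall : quasiConst v ^ 23 * M ^ 2 * δ < 1)
    (hP : distZero g₂ g₃ v P ≤ δ) (hQ : distZero g₂ g₃ v Q ≤ δ) :
    distZero g₂ g₃ v (P + Q) ≤ quasiConst v ^ 2 * δ := by
  have hq := isQuasiAbs_absV hv
  have hc := hq.one_le
  have hδ : 0 ≤ δ := (distZero_nonneg P).trans hP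
  have hle : δ ≤ quasiConst v ^ 2 * δ := le_mul_of_one_le_left hδ (one_le_pow₀ hc)
  have hδ1 : δ < 1 := by
    refine lt_of_le_of_lt (le_mul_of_one_le_left hδ ?_) hsmall
    exact one_le_mul_of_one_le_of_one_le (one_le_pow₀ hc) (one_le_pow₀ hM)
  rcases P with _ | ⟨x₁, y₁, h₁⟩
  · rw [← Point.zero_def, zero_add]
    exact hQ.trans hle
  rcases Q with _ | ⟨x₂, y₂, h₂⟩
  · rw [← Point.zero_def, add_zero]
    exact hP.trans hle
  by_cases hxy : x₁ = x₂ ∧ y₁ = (curve g₂ g₃).negY x₂ y₂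
  · rw [Point.add_of_Y_eq hxy.1 hxy.2, distZero_zero hv]
    exact hδ.trans hle
  obtain ⟨hy₁, ht₁, hw₁⟩ := bounds_of_distZero_some_le hv hδ1 hP
  obtain ⟨hy₂, ht₂, hw₂⟩ := bounds_of_distZero_some_le hv hδ1 hQ
  -- Comparing coefficients in this factorisation gives Vieta's relations for `chord_bound`, for
  -- chords and tangents alike.
  have hpoly := addPolynomial_slope h₁.1 h₂.1 hxy
  have hline₂ : y₂ = (curve g₂ g₃).slope x₁ x₂ y₁ y₂ * (x₂ - x₁) + y₁ := by
    by_cases hx : x₁ = x₂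
    · have hy := Y_eq_of_Y_ne h₁.1 h₂.1 hx fun h => hxy ⟨hx, h⟩
      rw [hx, hy]; ring
    · rw [slope_of_X_ne hx]
      have : x₁ - x₂ ≠ 0 := sub_ne_zero.2 hx
      field_simp
      ring
  rw [Point.add_some hxy]
  generalize nonsingular_add h₁ h₂ hxy = hns
  clear hP hQ
  generalize (curve g₂ g₃).slope x₁ x₂ y₁ y₂ = L at *
  rw [addPolynomial_eq, neg_inj, Cubic.prod_X_sub_C_eq, Cubic.toPoly_injective] at hpoly
  have hb := congrArg Cubic.c hpoly
  have hd := congrArg Cubic.d hpoly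
  have hX : (curve g₂ g₃).addX x₁ x₂ L = L ^ 2 - x₁ - x₂ := by simp [addX, curve]
  simp only [curve] at hb hd
  have l₁ : L * x₁ + (y₁ - L * x₁) = y₁ := by ring
  have l₂ : L * x₂ + (y₁ - L * x₁) = y₂ := by rw [hline₂]; ring
  -- The third intersection point is -(P + Q); the sign does not affect the distance.
  have hY : (curve g₂ g₃).addY x₁ x₂ y₁ L
      = -(L * (curve g₂ g₃).addX x₁ x₂ L + (y₁ - L * x₁)) := by
    rw [addY, negY_curve, negAddY]; ring
  have key := chord_bound hq hM hδ hsmall (x₁ := x₁) (x₂ := x₂)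
    (x₃ := (curve g₂ g₃).addX x₁ x₂ L) (L := L) (N := y₁ - L * x₁) hg₂ hg₃
    (by rwa [l₁]) (by rwa [l₂]) hX
    (by simp only [curve]; linear_combination -hb) (by simp only [curve]; linear_combination hd)
    (by rwa [l₁]) (by rwa [l₂]) (by rwa [l₁]) (by rwa [l₂])
  refine distZero_some_le hv ?_ ?_ ?_
  · rw [hY]
    exact neg_ne_zero.2 key.1
  · rw [hY, mul_neg, div_neg, hq.neg]
    exact key.2.1
  · rw [hY, mul_neg, div_neg, hq.neg]
    exact key.2.2.trans hle

/-- If two points are close to the origin, then so is their difference. -/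
theorem distZero_sub_lt {P Q : (curve g₂ g₃).Point} {X : ℝ} (hX : 0 ≤ X)
    (hP : distZero g₂ g₃ v P < Real.exp (-X - 2 * mConst g₂ g₃ v - cConst v))
    (hQ : distZero g₂ g₃ v Q < Real.exp (-X - 2 * mConst g₂ g₃ v - cConst v)) :
    localDegree v ≠ 0 ∧ distZero g₂ g₃ v (P - Q) < Real.exp (-X) := by
  have hm := mConst_nonneg g₂ g₃ v
  have hc := cConst_nonneg v
  have hv : localDegree v ≠ 0 := by
    intro h0
    rw [distZero_of_localDegree_eq_zero h0, Real.one_lt_exp_iff] at hP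
    linarith
  refine ⟨hv, ?_⟩
  have hq := (isQuasiAbs_absV hv).one_le
  set M := max 1 (max (absV v g₂) (absV v g₃)) with hMdef
  have hM : 1 ≤ M := le_max_left _ _
  have hMe : Real.exp (mConst g₂ g₃ v) = M := Real.exp_log (zero_lt_one.trans_le hM)
  set δ := max (distZero g₂ g₃ v P) (distZero g₂ g₃ v (-Q)) with hδ
  have hδ0 : 0 ≤ δ := (distZero_nonneg P).trans (le_max_left _ _)
  have hδlt : δ < Real.exp (-X - 2 * mConst g₂ g₃ v - cConst v) :=
    max_lt hP (by rwa [distZero_neg hv])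
  have h23 : quasiConst v ^ 23 * M ^ 2 * δ < Real.exp (-X) := by
    calc quasiConst v ^ 23 * M ^ 2 * δ ≤ Real.exp (cConst v) * M ^ 2 * δ := by
          gcongr; exact quasiConst_pow_le v
      _ < Real.exp (cConst v) * M ^ 2 * Real.exp (-X - 2 * mConst g₂ g₃ v - cConst v) := by
          gcongr
      _ = Real.exp (-X) := by
          rw [← hMe, ← Real.exp_nat_mul, ← Real.exp_add, ← Real.exp_add]
          congr 1
          push_cast
          ring
  rw [sub_eq_add_neg]
  refine lt_of_le_of_lt (distZero_add_le hv hM ((le_max_left _ _).trans (le_max_right _ _))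
    ((le_max_right _ _).trans (le_max_right _ _))
    (h23.trans_le (Real.exp_le_one_iff.2 (neg_nonpos.2 hX))) (le_max_left _ _)
    (le_max_right _ _)) (lt_of_le_of_lt ?_ h23)
  -- The loss c² in the addition is covered by the margin c ^ 23 * M ^ 2 already built into the
  -- hypothesis.
  have h2 : quasiConst v ^ 2 ≤ quasiConst v ^ 23 := pow_le_pow_right₀ hq (by norm_num)
  have hM2 : 1 ≤ M ^ 2 := one_le_pow₀ hM
  gcongr
  exact h2.trans (le_mul_of_one_le_right (by positivity) hM2)

end LocalDistance

/-! ### The Liouville inequality -/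

section Liouville

open Height WeierstrassCurve.Affine

variable {K : Type*} [Field K] [NumberField K] {g₂ g₃ : K}

/-- The height of a tuple with a coordinate `1` bounds its local contributions at finitely many
places. -/
theorem sum_log_iSup_le_logHeight {ι : Type*} [Finite ι] {p : ι → K} {i : ι} (hi : p i = 1)
    (S : Finset (Place K)) :
    ∑ v ∈ S, Sum.elim (fun v : InfinitePlace K => v.mult * Real.log (⨆ i, v (p i)))
      (fun v : FinitePlace K => Real.log (⨆ i, v (p i))) v ≤ logHeight p := by
  classical
  have hp : p ≠ 0 := fun h => one_ne_zero (hi.symm.trans (congrFun h i))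
  -- All local contributions are nonnegative because of the coordinate 1, so places outside S may be
  -- dropped.
  have hinf : ∀ v : InfinitePlace K, 1 ≤ ⨆ i, v (p i) := fun v => one_le_iSup_of_eq_one v.1 hi
  have hfin : ∀ v : FinitePlace K, 1 ≤ ⨆ i, v (p i) := fun v => one_le_iSup_of_eq_one v.1 hi
  have hsupp : (Function.mulSupport fun v : FinitePlace K => ⨆ i, v (p i)).Finite :=
    hasFiniteMulSupport_iSup hp
  rw [logHeight_eq_log_mulHeight, NumberField.mulHeight_eq hp,
    finprod_eq_prod_of_mulSupport_subset (s := hsupp.toFinset ∪ S.toRight) _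
      (by intro v hv; simpa using Or.inl hv),
    Real.log_mul, Real.log_prod, Real.log_prod, ← Finset.toLeft_disjSum_toRight (u := S),
    Finset.sum_disjSum, Finset.toLeft_disjSum_toRight]
  · simp only [Sum.elim_inl, Sum.elim_inr, Real.log_pow]
    refine add_le_add ?_ ?_
    · exact Finset.sum_le_sum_of_subset_of_nonneg (Finset.subset_univ _) fun v _ _ =>
        mul_nonneg (Nat.cast_nonneg _) (Real.log_nonneg (hinf v))
    · exact Finset.sum_le_sum_of_subset_of_nonneg Finset.subset_union_right fun v _ _ =>
        Real.log_nonneg (hfin v)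
  · exact fun v _ => (zero_lt_one.trans_le (hfin v)).ne'
  · exact fun v _ => (pow_pos (zero_lt_one.trans_le (hinf v)) _).ne'
  · exact Finset.prod_ne_zero_iff.2 fun v _ => (pow_pos (zero_lt_one.trans_le (hinf v)) _).ne'
  · exact Finset.prod_ne_zero_iff.2 fun v _ => (zero_lt_one.trans_le (hfin v)).ne'

/-- One of the minors of (x, 2y, 1) and (0, 1, 0) is -1, so the numerator of the distance is at
least 1. -/
theorem inv_max3_le_distZero {v : Place K} (hv : localDegree v ≠ 0) {P : (curve g₂ g₃).Point}
    (hP : P ≠ 0) : 1 ≤ max3 v (coords g₂ g₃ P 0) (coords g₂ g₃ P 1) (coords g₂ g₃ P 2) ∧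
    (max3 v (coords g₂ g₃ P 0) (coords g₂ g₃ P 1) (coords g₂ g₃ P 2))⁻¹ ≤
      distZero g₂ g₃ v P := by
  have hq := isQuasiAbs_absV hv
  rcases P with _ | ⟨x, y, h⟩
  · exact absurd rfl hP
  · have h1 : 1 ≤ max3 v x (2 * y) 1 := by
      simp [max3, hq.one]
    refine ⟨h1, ?_⟩
    rw [distZero_some hv]
    simp only [coords, Matrix.cons_val, max3, hq.one] at h1 ⊢
    rw [inv_eq_one_div]
    gcongr
    exact le_max_right _ _

theorem max3_le_iSup_rpow (v : FinitePlace K) (p : Fin 3 → K) :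
    max3 (.inr v) (p 0) (p 1) (p 2)
      ≤ (⨆ i, v (p i)) ^ (1 / (localDegree (.inr v : Place K) : ℝ)) := by
  have : ∀ i, absV (.inr v) (p i)
      ≤ (⨆ i, v (p i)) ^ (1 / (localDegree (.inr v : Place K) : ℝ)) := fun i =>
    Real.rpow_le_rpow (apply_nonneg v _) (apply_le_iSup v.1 p i) (by positivity)
  exact max_le (this 0) (max_le (this 1) (this 2))

theorem localDegree_mul_neg_log_distZero_le {v : Place K} (hv : localDegree v ≠ 0)
    {P : (curve g₂ g₃).Point} (hP : P ≠ 0) :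
    localDegree v * -Real.log (distZero g₂ g₃ v P) ≤
      Sum.elim (fun v : InfinitePlace K => v.mult * Real.log (⨆ i, v (coords g₂ g₃ P i)))
        (fun v : FinitePlace K => Real.log (⨆ i, v (coords g₂ g₃ P i))) v := by
  obtain ⟨h1, h2⟩ := inv_max3_le_distZero hv hP
  have hpos := zero_lt_one.trans_le h1
  have h3 := Real.log_le_log (inv_pos.2 hpos) h2
  rw [Real.log_inv] at h3
  have hlog : -Real.log (distZero g₂ g₃ v P) ≤
      Real.log (max3 v (coords g₂ g₃ P 0) (coords g₂ g₃ P 1) (coords g₂ g₃ P 2)) := by linarith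
  rcases v with v | v
  · refine mul_le_mul_of_nonneg_left (hlog.trans (Real.log_le_log hpos ?_)) (Nat.cast_nonneg _)
    have := apply_le_iSup v.1 (coords g₂ g₃ P)
    exact max_le (this 0) (max_le (this 1) (this 2))
  · have h4 := hlog.trans (Real.log_le_log hpos (max3_le_iSup_rpow v _))
    have hd : (0 : ℝ) < localDegree (.inr v : Place K) := by
      exact_mod_cast Nat.pos_of_ne_zero hv
    have hsup : 0 < ⨆ i, v (coords g₂ g₃ P i) := by
      obtain ⟨i, hi⟩ := Function.ne_iff.1 (coords_ne_zero g₂ g₃ P)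
      exact (v.1.pos hi).trans_le (apply_le_iSup v.1 (coords g₂ g₃ P) i)
    rw [Real.log_rpow hsup] at h4
    calc _ ≤ (localDegree (.inr v : Place K) : ℝ)
          * (1 / localDegree (.inr v : Place K) * Real.log (⨆ i, v (coords g₂ g₃ P i))) :=
          mul_le_mul_of_nonneg_left h4 hd.le
      _ = _ := by rw [Sum.elim_inr]; field_simp

/-- The Liouville inequality: -log dist_v(P, 0) is at most the local contribution to the height.
Strictness survives the summation because the weights sum to 1, so S is nonempty. -/
theorem lt_pointHeight {S : Finset (Place K)} {lam : Place K → ℝ}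
    (hsum : ∑ v ∈ S, (localDegree v : ℝ) / (Module.finrank ℚ K : ℝ) * lam v = 1)
    {P : (curve g₂ g₃).Point} (hP : P ≠ 0) {r : ℝ}
    (hS : ∀ v ∈ S, localDegree v ≠ 0 ∧ distZero g₂ g₃ v P < Real.exp (-(lam v * r))) :
    r < pointHeight g₂ g₃ P := by
  have hd : (0 : ℝ) < Module.finrank ℚ K := by exact_mod_cast Module.finrank_pos
  have hne : S.Nonempty := by
    rw [Finset.nonempty_iff_ne_empty]
    rintro rfl
    simp at hsum
  have hi : ∃ i, (coords g₂ g₃ P) i = 1 := by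
    rcases P with _ | ⟨x, y, h⟩
    · exact ⟨1, rfl⟩
    · exact ⟨2, rfl⟩
  obtain ⟨i, hi⟩ := hi
  have h1 : ∑ v ∈ S, (localDegree v : ℝ) * (lam v * r) < logHeight (coords g₂ g₃ P) := by
    refine lt_of_lt_of_le (Finset.sum_lt_sum_of_nonempty hne fun v hv => ?_)
      (sum_log_iSup_le_logHeight hi S)
    obtain ⟨hv0, hv1⟩ := hS v hv
    refine lt_of_lt_of_le ?_ (localDegree_mul_neg_log_distZero_le hv0 hP)
    obtain ⟨ha, hb⟩ := inv_max3_le_distZero hv0 hP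
    have hpos : 0 < distZero g₂ g₃ v P := (inv_pos.2 (zero_lt_one.trans_le ha)).trans_le hb
    have := (Real.log_lt_iff_lt_exp hpos).2 hv1
    have : (0 : ℝ) < localDegree v := by exact_mod_cast Nat.pos_of_ne_zero hv0
    gcongr
    linarith
  have h2 : ∑ v ∈ S, (localDegree v : ℝ) * (lam v * r) = Module.finrank ℚ K * r := by
    calc _ = (∑ v ∈ S, (localDegree v : ℝ) / (Module.finrank ℚ K : ℝ) * lam v)
          * (Module.finrank ℚ K * r) := by
          rw [Finset.sum_mul]
          refine Finset.sum_congr rfl fun v _ => ?_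
          field_simp
      _ = _ := by rw [hsum, one_mul]
  rw [h2] at h1
  rw [pointHeight_eq, NumberField.totalWeight_eq_finrank, lt_div_iff₀ hd]
  linarith

end Liouville

/-! ### The gap principle. -/

/-- The elementary inequality behind the gap principle: for vectors of squared lengths `A ≤ B` whose
angle has cosine at least `1 - ε / 8`, the squared length `D` of the difference is small unless
`B` is large. -/
theorem sq_length_sub_le {A B D cosine ε : ℝ} (hA : 0 < A) (hAB : A ≤ B) (hε : 0 ≤ ε)
    (hε1 : ε ≤ 1) (hcos : 1 - ε / 8 ≤ cosine) (hD : D = A + B - 2 * (cosine * (√A * √B)))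
    (hB : B < (1 + √ε / 3) * A) : D ≤ 23 / 72 * ε * A := by
  obtain ⟨a, ha, rfl⟩ : ∃ a, 0 < a ∧ a ^ 2 = A := ⟨√A, Real.sqrt_pos.2 hA, Real.sq_sqrt hA.le⟩
  obtain ⟨b, hb, rfl⟩ : ∃ b, 0 < b ∧ b ^ 2 = B :=
    ⟨√B, Real.sqrt_pos.2 (hA.trans_le hAB), Real.sq_sqrt (hA.le.trans hAB)⟩
  obtain ⟨s, hs, rfl⟩ : ∃ s, 0 ≤ s ∧ s ^ 2 = ε := ⟨√ε, Real.sqrt_nonneg _, Real.sq_sqrt hε⟩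
  rw [Real.sqrt_sq ha.le, Real.sqrt_sq hb.le] at hD
  rw [Real.sqrt_sq hs] at hB
  have hs1 : s ≤ 1 := by nlinarith
  have hab : a ≤ b := by nlinarith
  have hba : b ≤ (1 + s / 6) * a := by
    refine (pow_le_pow_iff_left₀ hb.le (by positivity) two_ne_zero).1 ?_
    nlinarith [mul_nonneg (sq_nonneg s) (sq_nonneg a)]
  have h1 : D ≤ (b - a) ^ 2 + s ^ 2 / 4 * (a * b) := by
    rw [hD]
    nlinarith [mul_pos ha hb]
  have h2 : (b - a) ^ 2 ≤ (s / 6 * a) ^ 2 :=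
    pow_le_pow_left₀ (sub_nonneg.2 hab) (by linarith) 2
  have h3 : a * b ≤ 7 / 6 * a ^ 2 := by
    nlinarith
  -- The constant is 1/36 + (1/4)(7/6) = 23/72.
  nlinarith [mul_le_mul_of_nonneg_left h3 (sq_nonneg s)]

/-- The gap principle for points that are close to the origin at the places of `S`. -/
theorem gap_principle {K : Type*} [Field K] [NumberField K] [DecidableEq K]
    (g₂ g₃ : K) (hΔ : g₂ ^ 3 - 27 * g₃ ^ 2 ≠ 0)
    (S : Finset (Place K)) (lam : Place K → ℝ)
    (hlam : ∀ v ∈ S, 0 ≤ lam v)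
    (hsum : ∑ v ∈ S,
      (localDegree v : ℝ) / (Module.finrank ℚ K : ℝ) * lam v = 1)
    (ε : ℝ) (hε : 0 < ε)
    (x₁ x₂ : (curve g₂ g₃).Point) (hne : x₁ ≠ x₂)
    (hcos : 1 - ε / 8 ≤ cosAngle g₂ g₃ x₁ x₂)
    (hle : neronTate g₂ g₃ x₁ ≤ neronTate g₂ g₃ x₂)
    (hlarge : 1 / ε * (54 * eta g₂ g₃ + 204) ≤ neronTate g₂ g₃ x₁)
    (hdist₁ : ∀ v ∈ S, distZero g₂ g₃ v x₁ <
      Real.exp (-lam v * ε * pointHeight g₂ g₃ x₁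
        - 2 * mConst g₂ g₃ v - cConst v))
    (hdist₂ : ∀ v ∈ S, distZero g₂ g₃ v x₂ <
      Real.exp (-lam v * ε * pointHeight g₂ g₃ x₂
        - 2 * mConst g₂ g₃ v - cConst v)) :
    (1 + √ε / 3) * neronTate g₂ g₃ x₁ ≤ neronTate g₂ g₃ x₂ := by
  have hη := eta_nonneg (g₂ := g₂) (g₃ := g₃)
  set A := neronTate g₂ g₃ x₁ with hA
  set B := neronTate g₂ g₃ x₂ with hB
  have hA0 : 0 < A := lt_of_lt_of_le (by positivity) hlarge
  have hlarge' : 54 * eta g₂ g₃ + 204 ≤ ε * A := by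
    rw [one_div, inv_mul_le_iff₀ hε] at hlarge
    exact hlarge
  have hx₁ : x₁ ≠ 0 := by
    rintro rfl
    rw [hA, neronTate_zero hΔ] at hA0
    exact lt_irrefl _ hA0
  have hnn₁ := pointHeight_nonneg x₁
  have hnn₂ := pointHeight_nonneg x₂
  have weaken : ∀ (P : (curve g₂ g₃).Point) (r : ℝ), 0 ≤ r → r ≤ pointHeight g₂ g₃ P →
      ∀ v ∈ S, distZero g₂ g₃ v P < Real.exp (-lam v * ε * pointHeight g₂ g₃ P
        - 2 * mConst g₂ g₃ v - cConst v) →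
      distZero g₂ g₃ v P < Real.exp (-(lam v * (ε * r)) - 2 * mConst g₂ g₃ v - cConst v) := by
    intro P r _ hr v hv h
    refine h.trans_le (Real.exp_le_exp.2 ?_)
    have := mul_le_mul_of_nonneg_left hr (mul_nonneg (hlam v hv) hε.le)
    linarith
  -- Liouville for x₁ itself gives ε h(x₁) < h(x₁).
  have hε1 : ε < 1 := by
    have := lt_pointHeight hsum hx₁ (r := ε * pointHeight g₂ g₃ x₁) fun v hv => by
      have h1 := weaken x₁ _ hnn₁ le_rfl v hv (hdist₁ v hv)
      have hX : 0 ≤ lam v * (ε * pointHeight g₂ g₃ x₁) :=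
        mul_nonneg (hlam v hv) (mul_nonneg hε.le hnn₁)
      refine ⟨(distZero_sub_lt hX h1 h1).1, h1.trans_le (Real.exp_le_exp.2 ?_)⟩
      linarith [mConst_nonneg g₂ g₃ v, cConst_nonneg v]
    by_contra! h
    nlinarith
  by_contra! hlt
  have hgap : ε * min (pointHeight g₂ g₃ x₁) (pointHeight g₂ g₃ x₂)
      < pointHeight g₂ g₃ (x₁ - x₂) := by
    have hmin : 0 ≤ min (pointHeight g₂ g₃ x₁) (pointHeight g₂ g₃ x₂) := le_min hnn₁ hnn₂
    exact lt_pointHeight hsum (sub_ne_zero.2 hne) fun v hv =>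
      distZero_sub_lt (mul_nonneg (hlam v hv) (mul_nonneg hε.le hmin))
        (weaken x₁ _ hmin (min_le_left _ _) v hv (hdist₁ v hv))
        (weaken x₂ _ hmin (min_le_right _ _) v hv (hdist₂ v hv))
  have c₁ := abs_le.1 (abs_pointHeight_sub_neronTate_le hΔ x₁)
  have c₂ := abs_le.1 (abs_pointHeight_sub_neronTate_le hΔ x₂)
  have c₃ := abs_le.1 (abs_pointHeight_sub_neronTate_le hΔ (x₁ - x₂))
  have hpar := neronTate_parallelogram hΔ x₁ x₂
  have hD : neronTate g₂ g₃ (x₁ - x₂) = A + B - 2 * (cosAngle g₂ g₃ x₁ x₂ * (√A * √B)) := by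
    have hne0 : √A * √B ≠ 0 :=
      (mul_pos (Real.sqrt_pos.2 hA0) (Real.sqrt_pos.2 (hA0.trans_le hle))).ne'
    rw [cosAngle, neronTateInner, ← hA, ← hB, div_mul_cancel₀ _ hne0]
    linarith
  have hup := sq_length_sub_le hA0 hle hε.le hε1.le hcos hD hlt
  have hmin : A - (18 * eta g₂ g₃ + 68) ≤
      min (pointHeight g₂ g₃ x₁) (pointHeight g₂ g₃ x₂) := le_min (by linarith) (by linarith)
  have h1 := mul_le_mul_of_nonneg_left hmin hε.le
  have h2 : ε * (18 * eta g₂ g₃ + 68) ≤ 18 * eta g₂ g₃ + 68 :=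
    mul_le_of_le_one_left (by positivity) hε1.le
  -- With κ = 18η + 68: ε(A - κ) < (23/72)εA + κ and ε < 1 give (49/72)εA < 2κ, whereas 3κ ≤ εA
  -- gives 2κ ≤ (48/72)εA.
  nlinarith

end EllipticApprox

end

theorem mainTheorem8 {K : Type*} [Field K] [NumberField K] [DecidableEq K]
    (g₂ g₃ : K) (hΔ : g₂ ^ 3 - 27 * g₃ ^ 2 ≠ 0)
    (S : Finset (EllipticApprox.Place K)) (lam : EllipticApprox.Place K → ℝ)
    (hlam : ∀ v ∈ S, 0 ≤ lam v)
    (hsum : ∑ v ∈ S,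
      (EllipticApprox.localDegree v : ℝ) / (Module.finrank ℚ K : ℝ) * lam v = 1)
    (ε : ℝ) (hε : 0 < ε)
    (x₁ x₂ : (EllipticApprox.curve g₂ g₃).Point) (hne : x₁ ≠ x₂)
    (hcos : 1 - ε / 8 ≤ EllipticApprox.cosAngle g₂ g₃ x₁ x₂)
    (hle : EllipticApprox.neronTate g₂ g₃ x₁ ≤ EllipticApprox.neronTate g₂ g₃ x₂)
    (hlarge : 1 / ε * (54 * EllipticApprox.eta g₂ g₃ + 204) ≤ EllipticApprox.neronTate g₂ g₃ x₁)
    (hdist₁ : ∀ v ∈ S, EllipticApprox.distZero g₂ g₃ v x₁ <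
      Real.exp (-lam v * ε * EllipticApprox.pointHeight g₂ g₃ x₁
        - 2 * EllipticApprox.mConst g₂ g₃ v - EllipticApprox.cConst v))
    (hdist₂ : ∀ v ∈ S, EllipticApprox.distZero g₂ g₃ v x₂ <
      Real.exp (-lam v * ε * EllipticApprox.pointHeight g₂ g₃ x₂
        - 2 * EllipticApprox.mConst g₂ g₃ v - EllipticApprox.cConst v)) :
    (1 + √ε / 3) * EllipticApprox.neronTate g₂ g₃ x₁ ≤ EllipticApprox.neronTate g₂ g₃ x₂ := by
  exact EllipticApprox.gap_principle g₂ g₃ hΔ S lam hlam hsum ε hε x₁ x₂ hne hcos hle hlarge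
    hdist₁ hdist₂
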